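/- Let $I=[0,1]$, $m\in\mathbb N$, and let $\|\cdot\|$ be the norm of $L^2(I)$. Let $f:\mathbb R\times\mathbb R\to\mathbb R$, $(u,t)\mapsto f(u,t)$, be Lipschitz continuous in $u$ with a constant independent of $t$, and continuous in $t$; let $D_k:\mathbb R\to\mathbb R$, $k=1,\dots,m$, be bounded and Lipschitz continuous; let $g\in L^2(I)$; and let $W_k\in L^2(I^2)$, $k=1,\dots,m$, satisfy, with constants $C_1,C_2$ independent of $k$, $$\operatorname*{ess\,sup}_{y\in I}\int_I|W_k(x,y)|\,dx\le C_1,\qquad \operatorname*{ess\,sup}_{x\in I}\int_I|W_k(x,y)|\,dy\le C_2 .$$ For $n\ge1$ put $I_i^n=[(i-1)/n,i/n)$ for $i<n$ and $I_n^n=[(n-1)/n,1]$, and for integrable $W$ on $I^2$ put $\langle W\rangle_{ij}^n=n^2\int_{I_i^n\times I_j^n}W(x,y)\,dx\,dy$. For each $k$ let $\alpha_{kn}=n^{-\gamma_k}$, and let the weights $w_{ij}^{kn}$, $i,j\in\{1,\dots,n\}$, of a sequence of graphs $G_{kn}$ be given in one of the following ways (which may differ for different $k$): - deterministic dense: $\gamma_k=0$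 and $w_{ij}^{kn}=\langle W_k\rangle_{ij}^n$; - random dense: $\gamma_k=0$, $0\le W_k\le1$, and $w_{ij}^{kn}\in\{0,1\}$ is random with $\mathbb P(w_{ij}^{kn}=1)=\langle W_k\rangle_{ij}^n$; - random sparse: $\gamma_k\in(0,\tfrac12)$, $W_k\ge0$, and $w_{ij}^{kn}\in\{0,1\}$ is random with $\mathbb P(w_{ij}^{kn}=1)=\alpha_{kn}\langle\min(\alpha_{kn}^{-1},W_k)\rangle_{ij}^n$. The graphs $G_{kn}$ may be directed or, if $W_k$ is symmetric, undirected, i.e. $w_{ij}^{kn}=w_{ji}^{kn}$. All random weights are defined on one probability space and, for each $n$, the weights $w_{ij}^{kn}$ of all random graphs are independent (for an undirected graph, those with $i\le j$). Let $(u_1^n(t),\dots,u_n^n(t))$, $t\in\mathbb R$, be the solution of $$\frac{d}{dt}u_i^n(t)=f(u_i^n(t),t)+\sum_{k=1}^m\frac1{n\alpha_{kn}}\sum_{j=1}^n w_{ij}^{kn}D_k\bigl(u_j^n(t)-u_i^n(t)\bigr),\qquad u_i^n(0)=n\int_{I_i^n}g(x)\,dx,\qquad i=1,\dots,n,$$ and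 put $\mathbf u_n(t)=\sum_{i=1}^n u_i^n(t)\mathbf 1_{I_i^n}\in L^2(I)$. Let $\mathbf u\in C^1(\mathbb R;L^2(I))$, $\mathbf u(t)=u(t,\cdot)$, be the solution of $$\frac{\partial}{\partial t}u(t,x)=f(u(t,x),t)+\sum_{k=1}^m\int_I W_k(x,y)D_k\bigl(u(t,y)-u(t,x)\bigr)\,dy,\qquad u(0,\cdot)=g .$$ Then for every $T>0$, $$\lim_{n\to\infty}\max_{t\in[0,T]}\|\mathbf u_n(t)-\mathbf u(t)\|=0\quad\text{almost surely}.$$ -/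

import Mathlib

/-
Both equations are ordinary differential equations `x' = f(x, t) + G x` in `L²(I)`, with `G` the
interaction operator of the graphons `W k`, respectively of the step kernels of the rescaled graphs.
The row and column sums of the graphs are almost surely eventually bounded (Chernoff bound and
Borel–Cantelli), so by Schur's test the network operators are eventually Lipschitz with a common
constant. On a fixed state they converge almost surely to the limit operator, by concentration of
the weights. Equi-Lipschitz continuity and a countable dense set of states make this convergence
uniform on the compact orbit `u '' [0, T]`, and Grönwall's inequality concludes.
-/

open MeasureTheory ProbabilityTheory Filter Topology Set
open scoped ENNReal NNReal

namespace OscillatorNetwork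

noncomputable section

/-- Lebesgue measure on `I = [0,1]`, as a measure on `ℝ` carried by `I`. -/
abbrev μI : Measure ℝ := volume.restrict (Icc (0 : ℝ) 1)

/-- The space `L²(I)`. -/
abbrev L2I : Type := Lp ℝ 2 μI

/-- The cells of the uniform mesh of `I`; nodes are numbered from `0`, so `cell n i` is
`[i/n, (i+1)/n)` for `i < n - 1` and `[(n-1)/n, 1]` for `i = n - 1`. -/
def cell (n : ℕ) (i : Fin n) : Set ℝ :=
  if (i : ℕ) + 1 < n then Ico ((i : ℝ) / n) (((i : ℝ) + 1) / n)
  else Icc ((i : ℝ) / n) (((i : ℝ) + 1) / n)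

theorem measurableSet_cell (n : ℕ) (i : Fin n) : MeasurableSet (cell n i) := by
  unfold cell
  split_ifs
  · exact measurableSet_Ico
  · exact measurableSet_Icc

/-- The cell average `⟨W⟩ᵢⱼⁿ = n² ∫_{Iᵢ × Iⱼ} W`. -/
def cellAvg (W : ℝ × ℝ → ℝ) (n : ℕ) (i j : Fin n) : ℝ :=
  (n : ℝ) ^ 2 * ∫ p in cell n i ×ˢ cell n j, W p

/-- The step function `∑ᵢ vᵢ 1_{Iᵢ}` as an element of `L²(I)`. -/
def stepLp (n : ℕ) (v : Fin n → ℝ) : L2I :=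
  ∑ i, v i • indicatorConstLp 2 (measurableSet_cell n i) (measure_ne_top μI _) (1 : ℝ)

/-- The three kinds of graph sequences. -/
inductive GraphType
  | deterministicDense
  | randomDense
  | randomSparse

/-- The scaling factor `αₙ = n^{-γ}`. -/
def scaling (γ : ℝ) (n : ℕ) : ℝ := (n : ℝ) ^ (-γ)

/-- `w n k i j` is the weight of the edge `j → i` in the `k`-th graph on `n` nodes.
The predicate says that these weights are generated from the graphons `W k`, where `ty k` is the
kind of the `k`-th sequence, `und k` says whether its graphs are undirected, and the scaling
factors are `n ^ (-γ k)`. Nothing is assumed on the joint law for different `n`. -/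
structure IsGraphSequence {Ω : Type*} [MeasurableSpace Ω] (P : Measure Ω) {m : ℕ}
    (ty : Fin m → GraphType) (und : Fin m → Prop) (W : Fin m → ℝ × ℝ → ℝ) (γ : Fin m → ℝ)
    (w : (n : ℕ) → Fin m → Fin n → Fin n → Ω → ℝ) : Prop where
  deterministic : ∀ k, ty k = .deterministicDense →
    ∀ n i j ω, w n k i j ω = cellAvg (W k) n i j
  measurable : ∀ n k i j, Measurable (w n k i j)
  zero_or_one : ∀ k, ty k ≠ .deterministicDense →
    ∀ n i j ω, w n k i j ω = 0 ∨ w n k i j ω = 1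
  dense_range : ∀ k, ty k = .randomDense →
    ∀ᵐ p ∂(μI.prod μI), W k p ∈ Icc (0 : ℝ) 1
  dense_prob : ∀ k, ty k = .randomDense → ∀ n i j,
    P {ω | w n k i j ω = 1} = ENNReal.ofReal (cellAvg (W k) n i j)
  sparse_nonneg : ∀ k, ty k = .randomSparse → ∀ᵐ p ∂(μI.prod μI), 0 ≤ W k p
  sparse_prob : ∀ k, ty k = .randomSparse → ∀ n i j,
    P {ω | w n k i j ω = 1} =
      ENNReal.ofReal (scaling (γ k) n *
        cellAvg (fun p => min (scaling (γ k) n)⁻¹ (W k p)) n i j)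
  graphon_symm : ∀ k, und k → ∀ᵐ p ∂(μI.prod μI), W k p = W k p.swap
  weight_symm : ∀ k, und k → ∀ n i j ω, w n k i j ω = w n k j i ω
  /-- For each `n`, all edges of all graphs are independent; in an undirected graph the edges are
  the unordered pairs, listed as `i ≤ j`. (Deterministic weights are constants.) -/
  indep : ∀ n, iIndepFun
    (fun (e : {e : Fin m × Fin n × Fin n // und e.1 → e.2.1 ≤ e.2.2}) ω =>
      w n e.1.1 e.1.2.1 e.1.2.2 ω) P

/-- `v` solves the network equation on `n` nodes with weights `w k i j` and scaling factors `α k`,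
started from the cell averages of `g`. -/
structure IsDiscreteSolution {m : ℕ} (f : ℝ → ℝ → ℝ) (D : Fin m → ℝ → ℝ) (g : L2I) (n : ℕ)
    (α : Fin m → ℝ) (w : Fin m → Fin n → Fin n → ℝ) (v : ℝ → Fin n → ℝ) : Prop where
  initial : ∀ i, v 0 i = n * ∫ x in cell n i, g x
  ode : ∀ (t : ℝ) (i : Fin n), HasDerivAt (fun s => v s i)
    (f (v t i) t + ∑ k, 1 / (n * α k) * ∑ j, w k i j * D k (v t j - v t i)) t

/-- `u ∈ C¹(ℝ; L²(I))` solves the continuum limit with initial value `g`. -/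
structure IsContinuumSolution {m : ℕ} (f : ℝ → ℝ → ℝ) (D : Fin m → ℝ → ℝ)
    (W : Fin m → ℝ × ℝ → ℝ) (g : L2I) (u : ℝ → L2I) : Prop where
  contDiff : ContDiff ℝ 1 u
  initial : u 0 = g
  equation : ∀ t, ((deriv u t : L2I) : ℝ → ℝ) =ᵐ[μI] fun x =>
    f (u t x) t + ∑ k, ∫ y, W k (x, y) * D k (u t y - u t x) ∂μI

end

end OscillatorNetwork

namespace OscillatorNetwork

noncomputable section

section Preliminaries

variable {X : Type*} [MeasurableSpace X] {μ : Measure X}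

theorem enorm_sub_sq_le (a b : ℝ) : ‖a - b‖ₑ ^ 2 ≤ 2 * (‖a‖ₑ ^ 2 + ‖b‖ₑ ^ 2) := by
  rw [Real.enorm_eq_ofReal_abs, Real.enorm_eq_ofReal_abs, Real.enorm_eq_ofReal_abs,
    ← ENNReal.ofReal_pow (abs_nonneg _), ← ENNReal.ofReal_pow (abs_nonneg _),
    ← ENNReal.ofReal_pow (abs_nonneg _), ← ENNReal.ofReal_add (by positivity) (by positivity),
    ← ENNReal.ofReal_ofNat 2, ← ENNReal.ofReal_mul zero_le_two]
  refine ENNReal.ofReal_le_ofReal ?_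
  simp only [sq_abs]
  linarith [sq_nonneg (a + b)]

theorem eLpNorm_two_sq (μ : Measure X) (h : X → ℝ) :
    eLpNorm h 2 μ ^ 2 = ∫⁻ x, ‖h x‖ₑ ^ 2 ∂μ := by
  simpa using eLpNorm_nnreal_pow_eq_lintegral (μ := μ) (f := h) (p := 2) (by norm_num)

theorem lintegral_mul_sq_le {a b : X → ℝ≥0∞} (ha : AEMeasurable a μ) (hb : AEMeasurable b μ) :
    (∫⁻ x, a x * b x ∂μ) ^ 2 ≤ (∫⁻ x, a x ∂μ) * ∫⁻ x, a x * b x ^ 2 ∂μ := by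
  have hsplit : ∀ x, a x ^ (1 / 2 : ℝ) * (a x ^ (1 / 2 : ℝ) * b x) = a x * b x := fun x => by
    rw [← mul_assoc, ← ENNReal.rpow_add_of_nonneg _ _ (by norm_num) (by norm_num)]
    norm_num
  have hholder := ENNReal.lintegral_mul_le_Lp_mul_Lq μ Real.HolderConjugate.two_two
    (ha.pow_const (1 / 2 : ℝ)) ((ha.pow_const (1 / 2 : ℝ)).mul hb)
  simp only [Pi.mul_apply, hsplit] at hholder
  calc (∫⁻ x, a x * b x ∂μ) ^ 2 ≤ _ := pow_le_pow_left' hholder 2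
    _ = _ := by
      rw [mul_pow]
      simp only [← ENNReal.rpow_natCast, ← ENNReal.rpow_mul,
        ENNReal.mul_rpow_of_nonneg _ _ zero_le_two]
      norm_num

/-- The class in `L²` of a square integrable function, with junk value `0`. It turns the vector
fields of the evolution equations into total maps on `L²`. -/
def toL2 (μ : Measure X) (h : X → ℝ) : Lp ℝ 2 μ :=
  open Classical in if hh : MemLp h 2 μ then hh.toLp h else 0

theorem toL2_of_memLp {h : X → ℝ} (hh : MemLp h 2 μ) : toL2 μ h = hh.toLp h := dif_pos hh

theorem coeFn_toL2 {h : X → ℝ} (hh : MemLp h 2 μ) : toL2 μ h =ᵐ[μ] h := by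
  rw [toL2_of_memLp hh]
  exact hh.coeFn_toLp

theorem toL2_eq {h : X → ℝ} {ξ : Lp ℝ 2 μ} (hξ : h =ᵐ[μ] ξ) : toL2 μ h = ξ := by
  rw [toL2_of_memLp ((memLp_congr_ae hξ).2 (Lp.memLp ξ))]
  exact Lp.ext ((MemLp.coeFn_toLp _).trans hξ)

theorem edist_toL2 {h k : X → ℝ} (hh : MemLp h 2 μ) (hk : MemLp k 2 μ) :
    edist (toL2 μ h) (toL2 μ k) = eLpNorm (h - k) 2 μ := by
  rw [toL2_of_memLp hh, toL2_of_memLp hk, Lp.edist_toLp_toLp]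

end Preliminaries

section SchurKernels

variable {X : Type*} [MeasurableSpace X] {μ : Measure X}

/-- A kernel whose rows and columns have `L¹`-norm at most `C`: the hypothesis of Schur's test. -/
structure IsSchurKernel (μ : Measure X) (K : X × X → ℝ) (C : ℝ≥0) : Prop where
  aestronglyMeasurable : AEStronglyMeasurable K (μ.prod μ)
  row : ∀ᵐ x ∂μ, ∫⁻ y, ‖K (x, y)‖ₑ ∂μ ≤ C
  col : ∀ᵐ y ∂μ, ∫⁻ x, ‖K (x, y)‖ₑ ∂μ ≤ C

/-- The velocity `x ↦ ∫ K(x, y) D(φ(y) - φ(x)) dy` which the coupling function `D` along the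
kernel `K` contributes in the state `φ`. -/
def interaction (μ : Measure X) (K : X × X → ℝ) (D : ℝ → ℝ) (φ : X → ℝ) (x : X) : ℝ :=
  ∫ y, K (x, y) * D (φ y - φ x) ∂μ

namespace IsSchurKernel

variable {K K' : X × X → ℝ} {C C' : ℝ≥0}

theorem of_essSup_le (hm : AEStronglyMeasurable K (μ.prod μ))
    (hrow : essSup (fun x => ∫⁻ y, ‖K (x, y)‖ₑ ∂μ) μ ≤ C)
    (hcol : essSup (fun y => ∫⁻ x, ‖K (x, y)‖ₑ ∂μ) μ ≤ C) : IsSchurKernel μ K C where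
  aestronglyMeasurable := hm
  row := (ENNReal.ae_le_essSup _).mono fun _ h => h.trans hrow
  col := (ENNReal.ae_le_essSup _).mono fun _ h => h.trans hcol

theorem weaken (hK : IsSchurKernel μ K C) (h : C ≤ C') : IsSchurKernel μ K C' where
  aestronglyMeasurable := hK.aestronglyMeasurable
  row := hK.row.mono fun _ hx => hx.trans (by exact_mod_cast h)
  col := hK.col.mono fun _ hy => hy.trans (by exact_mod_cast h)

theorem mono (hK : IsSchurKernel μ K C) (hm : AEStronglyMeasurable K' (μ.prod μ))
    (h : ∀ p, |K' p| ≤ |K p|) : IsSchurKernel μ K' C where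
  aestronglyMeasurable := hm
  row := hK.row.mono fun _ hx => (lintegral_mono fun _ => enorm_le_iff_norm_le.2 (h _)).trans hx
  col := hK.col.mono fun _ hy => (lintegral_mono fun _ => enorm_le_iff_norm_le.2 (h _)).trans hy

theorem integrable [IsFiniteMeasure μ] (hK : IsSchurKernel μ K C) : Integrable K (μ.prod μ) := by
  refine ⟨hK.aestronglyMeasurable, ?_⟩
  rw [hasFiniteIntegral_iff_enorm, lintegral_prod _ hK.aestronglyMeasurable.enorm]
  calc ∫⁻ x, ∫⁻ y, ‖K (x, y)‖ₑ ∂μ ∂μ ≤ ∫⁻ _x, C ∂μ := lintegral_mono_ae hK.row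
    _ < ∞ := by simpa using ENNReal.mul_lt_top ENNReal.coe_lt_top (measure_lt_top μ _)

variable [SFinite μ]

theorem swap (hK : IsSchurKernel μ K C) : IsSchurKernel μ (K ∘ Prod.swap) C :=
  ⟨hK.aestronglyMeasurable.prod_swap, hK.col, hK.row⟩

theorem sub (hK : IsSchurKernel μ K C) (hK' : IsSchurKernel μ K' C') :
    IsSchurKernel μ (K - K') (C + C') where
  aestronglyMeasurable := hK.aestronglyMeasurable.sub hK'.aestronglyMeasurable
  row := by
    filter_upwards [hK.row, hK'.row, hK.aestronglyMeasurable.prodMk_left] with x h h' hm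
    calc ∫⁻ y, ‖(K - K') (x, y)‖ₑ ∂μ ≤ ∫⁻ y, (‖K (x, y)‖ₑ + ‖K' (x, y)‖ₑ) ∂μ :=
          lintegral_mono fun y => enorm_sub_le
      _ ≤ ↑(C + C') := by
          rw [lintegral_add_left' hm.enorm, ENNReal.coe_add]
          exact add_le_add h h'
  col := by
    filter_upwards [hK.col, hK'.col, hK.aestronglyMeasurable.prod_swap.prodMk_left]
      with y h h' hm
    have hm : AEMeasurable (fun x => ‖K (x, y)‖ₑ) μ := hm.enorm
    calc ∫⁻ x, ‖(K - K') (x, y)‖ₑ ∂μ ≤ ∫⁻ x, (‖K (x, y)‖ₑ + ‖K' (x, y)‖ₑ) ∂μ :=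
          lintegral_mono fun x => enorm_sub_le
      _ ≤ ↑(C + C') := by
          rw [lintegral_add_left' hm, ENNReal.coe_add]
          exact add_le_add h h'

theorem lintegral_sq_le (hK : IsSchurKernel μ K C) {β : X × X → ℝ≥0∞}
    (hβ : AEMeasurable β (μ.prod μ)) :
    ∫⁻ x, (∫⁻ y, ‖K (x, y)‖ₑ * β (x, y) ∂μ) ^ 2 ∂μ ≤
      C * ∫⁻ p, ‖K p‖ₑ * β p ^ 2 ∂(μ.prod μ) := by
  rw [lintegral_prod _ (hK.aestronglyMeasurable.enorm.fun_mul (hβ.pow_const 2)),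
    ← lintegral_const_mul' _ _ ENNReal.coe_ne_top]
  refine lintegral_mono_ae ?_
  filter_upwards [hK.row, hK.aestronglyMeasurable.prodMk_left,
    hβ.aestronglyMeasurable.prodMk_left] with x hx hm hβx
  exact (lintegral_mul_sq_le hm.enorm hβx.aemeasurable).trans (by gcongr)

theorem lintegral_mul_enorm_sub_sq_le (hK : IsSchurKernel μ K C) {χ : X → ℝ}
    (hχ : AEStronglyMeasurable χ μ) :
    ∫⁻ p, ‖K p‖ₑ * ‖χ p.2 - χ p.1‖ₑ ^ 2 ∂(μ.prod μ) ≤ 4 * C * eLpNorm χ 2 μ ^ 2 := by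
  have hKm := hK.aestronglyMeasurable.enorm
  have hfst : ∫⁻ p, ‖K p‖ₑ * ‖χ p.1‖ₑ ^ 2 ∂(μ.prod μ) ≤ C * eLpNorm χ 2 μ ^ 2 := by
    rw [lintegral_prod _ (hKm.fun_mul (hχ.comp_fst.enorm.pow_const 2)), eLpNorm_two_sq,
      ← lintegral_const_mul' _ _ ENNReal.coe_ne_top]
    refine lintegral_mono_ae (hK.row.mono fun x hx => ?_)
    dsimp only
    rw [lintegral_mul_const' _ _ (by finiteness)]
    gcongr
  have hsnd : ∫⁻ p, ‖K p‖ₑ * ‖χ p.2‖ₑ ^ 2 ∂(μ.prod μ) ≤ C * eLpNorm χ 2 μ ^ 2 := by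
    rw [lintegral_prod_symm _ (hKm.fun_mul (hχ.comp_snd.enorm.pow_const 2)), eLpNorm_two_sq,
      ← lintegral_const_mul' _ _ ENNReal.coe_ne_top]
    refine lintegral_mono_ae (hK.col.mono fun y hy => ?_)
    dsimp only
    rw [lintegral_mul_const' _ _ (by finiteness)]
    gcongr
  calc ∫⁻ p, ‖K p‖ₑ * ‖χ p.2 - χ p.1‖ₑ ^ 2 ∂(μ.prod μ)
      ≤ ∫⁻ p, 2 * (‖K p‖ₑ * ‖χ p.2‖ₑ ^ 2 + ‖K p‖ₑ * ‖χ p.1‖ₑ ^ 2) ∂(μ.prod μ) := by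
        refine lintegral_mono fun p => ?_
        rw [← mul_add, mul_left_comm]
        gcongr
        exact enorm_sub_sq_le _ _
    _ ≤ 2 * (C * eLpNorm χ 2 μ ^ 2 + C * eLpNorm χ 2 μ ^ 2) := by
        rw [lintegral_const_mul' _ _ (by simp),
          lintegral_add_left' (hKm.fun_mul (hχ.comp_snd.enorm.pow_const 2))]
        gcongr
    _ = 4 * C * eLpNorm χ 2 μ ^ 2 := by ring

theorem eLpNorm_interaction_sq_le (hK : IsSchurKernel μ K C)
    {D : ℝ → ℝ} {B : ℝ} (hB : ∀ z, |D z| ≤ B) (φ : X → ℝ) :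
    eLpNorm (interaction μ K D φ) 2 μ ^ 2 ≤
      C * ENNReal.ofReal B ^ 2 * eLpNorm K 1 (μ.prod μ) := by
  calc eLpNorm (interaction μ K D φ) 2 μ ^ 2
      ≤ ∫⁻ x, (∫⁻ y, ‖K (x, y)‖ₑ * ENNReal.ofReal B ∂μ) ^ 2 ∂μ := by
        rw [eLpNorm_two_sq]
        refine lintegral_mono fun x => pow_le_pow_left' ?_ 2
        refine (enorm_integral_le_lintegral_enorm _).trans (lintegral_mono fun y => ?_)
        rw [enorm_mul, Real.enorm_eq_ofReal_abs (D _)]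
        gcongr
        exact hB _
    _ ≤ C * ∫⁻ p, ‖K p‖ₑ * ENNReal.ofReal B ^ 2 ∂(μ.prod μ) :=
        hK.lintegral_sq_le aemeasurable_const
    _ = C * ENNReal.ofReal B ^ 2 * eLpNorm K 1 (μ.prod μ) := by
        rw [lintegral_mul_const' _ _ (by finiteness), eLpNorm_one_eq_lintegral_enorm]
        ring

end IsSchurKernel

theorem aestronglyMeasurable_comp_sub {D : ℝ → ℝ} {φ : X → ℝ} (hD : Continuous D)
    (hφ : AEStronglyMeasurable φ μ) :
    AEStronglyMeasurable (fun p : X × X => D (φ p.2 - φ p.1)) (μ.prod μ) :=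
  hD.comp_aestronglyMeasurable (hφ.comp_snd.sub hφ.comp_fst)

variable [IsFiniteMeasure μ] {K K' : X × X → ℝ} {C C' : ℝ≥0}
variable {D : ℝ → ℝ} {B : ℝ} {L : ℝ≥0} {φ ψ : X → ℝ}

theorem IsSchurKernel.integrable_mul_comp_sub (hK : IsSchurKernel μ K C) (hD : Continuous D)
    (hB : ∀ z, |D z| ≤ B) (hφ : AEStronglyMeasurable φ μ) :
    Integrable (fun p : X × X => K p * D (φ p.2 - φ p.1)) (μ.prod μ) :=
  hK.integrable.mul_bdd (c := B) (aestronglyMeasurable_comp_sub hD hφ) (ae_of_all _ fun _ => hB _)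

theorem IsSchurKernel.memLp_interaction (hK : IsSchurKernel μ K C) (hD : Continuous D)
    (hB : ∀ z, |D z| ≤ B) (hφ : AEStronglyMeasurable φ μ) :
    MemLp (interaction μ K D φ) 2 μ := by
  refine MemLp.of_bound (hK.integrable_mul_comp_sub hD hB hφ).1.integral_prod_right'
    (C * B) (hK.row.mono fun x hx => ?_)
  have hB0 : 0 ≤ B := (abs_nonneg _).trans (hB 0)
  rw [← toReal_enorm, ← ENNReal.coe_toReal C, ← ENNReal.toReal_ofReal hB0, ← ENNReal.toReal_mul]
  refine ENNReal.toReal_mono (by finiteness) ?_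
  calc ‖interaction μ K D φ x‖ₑ ≤ ∫⁻ y, ‖K (x, y) * D (φ y - φ x)‖ₑ ∂μ :=
        enorm_integral_le_lintegral_enorm _
    _ ≤ ∫⁻ y, ‖K (x, y)‖ₑ * ENNReal.ofReal B ∂μ := lintegral_mono fun y => by
        rw [enorm_mul, Real.enorm_eq_ofReal_abs (D _)]
        gcongr
        exact hB _
    _ ≤ C * ENNReal.ofReal B := by
        rw [lintegral_mul_const' _ _ ENNReal.ofReal_ne_top]
        gcongr

theorem IsSchurKernel.eLpNorm_interaction_sub_le (hK : IsSchurKernel μ K C)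
    (hD : LipschitzWith L D) (hB : ∀ z, |D z| ≤ B) (hφ : AEStronglyMeasurable φ μ)
    (hψ : AEStronglyMeasurable ψ μ) :
    eLpNorm (interaction μ K D φ - interaction μ K D ψ) 2 μ ≤
      2 * L * C * eLpNorm (φ - ψ) 2 μ := by
  have hχ := hφ.sub hψ
  have hpointwise : ∀ᵐ x ∂μ, ‖(interaction μ K D φ - interaction μ K D ψ) x‖ₑ ≤
      ∫⁻ y, ‖K (x, y)‖ₑ * (L * ‖(φ - ψ) y - (φ - ψ) x‖ₑ) ∂μ := by
    filter_upwards [(hK.integrable_mul_comp_sub hD.continuous hB hφ).prod_right_ae,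
      (hK.integrable_mul_comp_sub hD.continuous hB hψ).prod_right_ae] with x h h'
    rw [Pi.sub_apply, interaction, interaction, ← integral_sub h h']
    refine (enorm_integral_le_lintegral_enorm _).trans (lintegral_mono fun y => ?_)
    rw [← mul_sub, enorm_mul, ← edist_eq_enorm_sub (D _)]
    gcongr
    refine (hD _ _).trans_eq ?_
    rw [edist_eq_enorm_sub, Pi.sub_apply, Pi.sub_apply]
    congr 2
    ring
  refine (ENNReal.pow_le_pow_left_iff two_ne_zero).1 ?_
  calc eLpNorm (interaction μ K D φ - interaction μ K D ψ) 2 μ ^ 2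
      ≤ ∫⁻ x, (∫⁻ y, ‖K (x, y)‖ₑ * (L * ‖(φ - ψ) y - (φ - ψ) x‖ₑ) ∂μ) ^ 2 ∂μ := by
        rw [eLpNorm_two_sq]
        exact lintegral_mono_ae (hpointwise.mono fun x hx => pow_le_pow_left' hx 2)
    _ ≤ C * ∫⁻ p, ‖K p‖ₑ * (L * ‖(φ - ψ) p.2 - (φ - ψ) p.1‖ₑ) ^ 2 ∂(μ.prod μ) :=
        hK.lintegral_sq_le ((hχ.comp_snd.sub hχ.comp_fst).enorm.const_mul _)
    _ = C * L ^ 2 * ∫⁻ p, ‖K p‖ₑ * ‖(φ - ψ) p.2 - (φ - ψ) p.1‖ₑ ^ 2 ∂(μ.prod μ) := by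
        simp only [mul_pow, mul_left_comm _ ((L : ℝ≥0∞) ^ 2)]
        rw [lintegral_const_mul' _ _ (by finiteness), mul_assoc]
    _ ≤ C * L ^ 2 * (4 * C * eLpNorm (φ - ψ) 2 μ ^ 2) := by
        gcongr
        exact hK.lintegral_mul_enorm_sub_sq_le hχ
    _ = (2 * L * C * eLpNorm (φ - ψ) 2 μ) ^ 2 := by ring

theorem IsSchurKernel.interaction_sub (hK : IsSchurKernel μ K C) (hK' : IsSchurKernel μ K' C')
    (hD : Continuous D) (hB : ∀ z, |D z| ≤ B) (hφ : AEStronglyMeasurable φ μ) :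
    interaction μ K D φ - interaction μ K' D φ =ᵐ[μ] interaction μ (K - K') D φ := by
  filter_upwards [(hK.integrable_mul_comp_sub hD hB hφ).prod_right_ae,
    (hK'.integrable_mul_comp_sub hD hB hφ).prod_right_ae] with x h h'
  simp only [Pi.sub_apply, interaction, ← integral_sub h h', sub_mul]

/-- The map on `L²` induced by `interaction`. -/
def interactionL2 (μ : Measure X) (K : X × X → ℝ) (D : ℝ → ℝ) (ξ : Lp ℝ 2 μ) : Lp ℝ 2 μ :=
  toL2 μ (interaction μ K D ξ)

theorem IsSchurKernel.lipschitzWith_interactionL2 (hK : IsSchurKernel μ K C)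
    (hD : LipschitzWith L D) (hB : ∀ z, |D z| ≤ B) :
    LipschitzWith (2 * L * C) (interactionL2 μ K D) := by
  intro ξ η
  rw [interactionL2, interactionL2,
    edist_toL2 (hK.memLp_interaction hD.continuous hB (Lp.aestronglyMeasurable ξ))
      (hK.memLp_interaction hD.continuous hB (Lp.aestronglyMeasurable η)), Lp.edist_def]
  exact_mod_cast hK.eLpNorm_interaction_sub_le hD hB (Lp.aestronglyMeasurable ξ)
    (Lp.aestronglyMeasurable η)

theorem IsSchurKernel.edist_interactionL2_sq_le (hK : IsSchurKernel μ K C)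
    (hK' : IsSchurKernel μ K' C') (hD : Continuous D) (hB : ∀ z, |D z| ≤ B) (ξ : Lp ℝ 2 μ) :
    edist (interactionL2 μ K D ξ) (interactionL2 μ K' D ξ) ^ 2 ≤
      ↑(C + C') * ENNReal.ofReal B ^ 2 * eLpNorm (K - K') 1 (μ.prod μ) := by
  have hξ := Lp.aestronglyMeasurable ξ
  rw [interactionL2, interactionL2,
    edist_toL2 (hK.memLp_interaction hD hB hξ) (hK'.memLp_interaction hD hB hξ),
    eLpNorm_congr_ae (hK.interaction_sub hK' hD hB hξ)]
  exact (hK.sub hK').eLpNorm_interaction_sq_le hB _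

theorem tendsto_interactionL2 {α : Type*} {l : Filter α} {V : α → X × X → ℝ}
    (hV : ∀ᶠ a in l, IsSchurKernel μ (V a) C) (hK : IsSchurKernel μ K C')
    (hVK : Tendsto (fun a => eLpNorm (V a - K) 1 (μ.prod μ)) l (𝓝 0)) (hD : Continuous D)
    (hB : ∀ z, |D z| ≤ B) (ξ : Lp ℝ 2 μ) :
    Tendsto (fun a => interactionL2 μ (V a) D ξ) l (𝓝 (interactionL2 μ K D ξ)) := by
  have hsq : Tendsto (fun a => edist (interactionL2 μ (V a) D ξ) (interactionL2 μ K D ξ) ^ 2)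
      l (𝓝 0) := by
    have hbound := ENNReal.Tendsto.const_mul (a := ↑(C + C') * ENNReal.ofReal B ^ 2) hVK
      (Or.inr (by finiteness))
    rw [mul_zero] at hbound
    exact tendsto_of_tendsto_of_tendsto_of_le_of_le' tendsto_const_nhds hbound
      (Eventually.of_forall fun _ => zero_le)
      (hV.mono fun a ha => ha.edist_interactionL2_sq_le hK hD hB ξ)
  rw [tendsto_iff_edist_tendsto_0]
  have hroot := hsq.ennrpow_const ((2 : ℕ) : ℝ)⁻¹
  rw [ENNReal.zero_rpow_of_pos (by norm_num)] at hroot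
  simpa only [ENNReal.pow_rpow_inv_natCast two_ne_zero] using hroot

end SchurKernels

section Fields

variable {X : Type*} [MeasurableSpace X] {μ : Measure X} [IsFiniteMeasure μ]

theorem memLp_comp_of_lipschitzWith {p : ℝ≥0∞} {L : ℝ≥0} {F : ℝ → ℝ} (hF : LipschitzWith L F)
    {φ : X → ℝ} (hφ : MemLp φ p μ) : MemLp (F ∘ φ) p μ := by
  have hF₀ : LipschitzWith L fun z => F z - F 0 := by
    simpa using hF.sub (LipschitzWith.const (F 0))
  have := (hF₀.comp_memLp (sub_self _) hφ).add (memLp_const (F 0))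
  simpa [Function.comp_def, Pi.add_def] using this

/-- The superposition (Nemytskii) operator `ξ ↦ F ∘ ξ` on `L²`. -/
def nemytskiiL2 (μ : Measure X) (F : ℝ → ℝ) (ξ : Lp ℝ 2 μ) : Lp ℝ 2 μ := toL2 μ (F ∘ ξ)

theorem lipschitzWith_nemytskiiL2 {L : ℝ≥0} {F : ℝ → ℝ} (hF : LipschitzWith L F) :
    LipschitzWith L (nemytskiiL2 μ F) := by
  intro ξ η
  rw [nemytskiiL2, nemytskiiL2, edist_toL2 (memLp_comp_of_lipschitzWith hF (Lp.memLp ξ))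
    (memLp_comp_of_lipschitzWith hF (Lp.memLp η)), Lp.edist_def]
  refine eLpNorm_le_nnreal_smul_eLpNorm_of_ae_le_mul (ae_of_all _ fun x => ?_) 2
  exact NNReal.coe_le_coe.1 (by simpa using hF.norm_sub_le (ξ x) (η x))

/-- The total velocity contributed by finitely many kernels `K k` with coupling functions `D k`. -/
def couplingL2 {κ : Type*} [Fintype κ] (μ : Measure X) (K : κ → X × X → ℝ) (D : κ → ℝ → ℝ)
    (ξ : Lp ℝ 2 μ) : Lp ℝ 2 μ := ∑ k, interactionL2 μ (K k) (D k) ξ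

theorem lipschitzWith_couplingL2 {κ : Type*} [Fintype κ] {K : κ → X × X → ℝ} {D : κ → ℝ → ℝ}
    {C : ℝ≥0} {L : κ → ℝ≥0} {B : κ → ℝ} (hK : ∀ k, IsSchurKernel μ (K k) C)
    (hD : ∀ k, LipschitzWith (L k) (D k)) (hB : ∀ k z, |D k z| ≤ B k) :
    LipschitzWith (∑ k, 2 * L k * C) (couplingL2 μ K D) := by
  refine LipschitzWith.of_dist_le_mul fun ξ η => ?_
  rw [NNReal.coe_sum, Finset.sum_mul]
  exact (dist_sum_sum_le _ _ _).trans <| Finset.sum_le_sum fun k _ =>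
    ((hK k).lipschitzWith_interactionL2 (hD k) (hB k)).dist_le_mul ξ η

end Fields

section Partitions

variable {X ι M : Type*} [Fintype ι] [AddCommMonoid M] {s : ι → Set X}

/-- The step function with value `v i` on the set `s i` of a finite partition. -/
def partitionStep (s : ι → Set X) (v : ι → M) (x : X) : M := ∑ i, (s i).indicator (fun _ => v i) x

theorem partitionStep_of_mem (hd : Pairwise (Function.onFun Disjoint s)) {i : ι} {x : X}
    (hx : x ∈ s i) (v : ι → M) : partitionStep s v x = v i := by
  rw [partitionStep, Finset.sum_eq_single i, indicator_of_mem hx]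
  · exact fun j _ hj =>
      indicator_of_notMem (fun hx' => Set.disjoint_left.1 (hd hj) hx' hx) _
  · simp

theorem map_partitionStep {N : Type*} [AddCommMonoid N] (hd : Pairwise (Function.onFun Disjoint s))
    {G : M → N} (hG : G 0 = 0) (v : ι → M) (x : X) :
    G (partitionStep s v x) = partitionStep s (G ∘ v) x := by
  by_cases h : ∃ i, x ∈ s i
  · obtain ⟨i, hi⟩ := h
    rw [partitionStep_of_mem hd hi, partitionStep_of_mem hd hi, Function.comp_apply]
  · push Not at h
    simp [partitionStep, h, hG]

variable [MeasurableSpace X] {μ : Measure X}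

theorem measurable_partitionStep (hs : ∀ i, MeasurableSet (s i)) (v : ι → ℝ) :
    Measurable (partitionStep s v) :=
  Finset.measurable_fun_sum _ fun i _ => measurable_const.indicator (hs i)

theorem lintegral_partitionStep (hs : ∀ i, MeasurableSet (s i)) (v : ι → ℝ≥0∞) :
    ∫⁻ x, partitionStep s v x ∂μ = ∑ i, v i * μ (s i) := by
  unfold partitionStep
  rw [lintegral_finsetSum _ fun i _ => measurable_const.indicator (hs i)]
  exact Finset.sum_congr rfl fun i _ => lintegral_indicator_const (hs i) _

theorem integral_partitionStep [IsFiniteMeasure μ] (hs : ∀ i, MeasurableSet (s i)) (v : ι → ℝ) :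
    ∫ x, partitionStep s v x ∂μ = ∑ i, μ.real (s i) * v i := by
  unfold partitionStep
  rw [integral_finsetSum _ fun i _ => (integrable_const _).indicator (hs i)]
  exact Finset.sum_congr rfl fun i _ => integral_indicator_const _ (hs i)

/-- The step function whose value on each set of the partition is the average of `h` there. -/
def partAvg (μ : Measure X) (s : ι → Set X) (h : X → ℝ) : X → ℝ :=
  partitionStep s fun i => ⨍ y in s i, h y ∂μ

theorem partAvg_sub {g h : X → ℝ} (hg : Integrable g μ) (hh : Integrable h μ) :
    partAvg μ s (g - h) = partAvg μ s g - partAvg μ s h := by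
  funext x
  simp only [partAvg, partitionStep, Pi.sub_apply, ← Finset.sum_sub_distrib]
  refine Finset.sum_congr rfl fun i _ => ?_
  simp only [setAverage_eq, integral_sub hg.integrableOn hh.integrableOn, smul_sub,
    indicator_sub]

variable [IsFiniteMeasure μ] {p : ℝ≥0∞}

theorem enorm_setAverage_rpow_mul_le (hp : 1 ≤ p) (hp_top : p ≠ ∞) {t : Set X} {h : X → ℝ}
    (hh : AEStronglyMeasurable h μ) :
    ‖⨍ y in t, h y ∂μ‖ₑ ^ p.toReal * μ t ≤ ∫⁻ y in t, ‖h y‖ₑ ^ p.toReal ∂μ := by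
  rcases eq_or_ne (μ t) 0 with h0 | h0
  · simp [h0]
  have hp0 : p ≠ 0 := (zero_lt_one.trans_le hp).ne'
  have : IsProbabilityMeasure ((μ t)⁻¹ • μ.restrict t) := cond_isProbabilityMeasure h0
  have hjensen : ‖⨍ y in t, h y ∂μ‖ₑ ≤ eLpNorm h p ((μ t)⁻¹ • μ.restrict t) := by
    rw [average, Measure.restrict_apply_univ]
    refine (enorm_integral_le_lintegral_enorm _).trans ?_
    rw [← eLpNorm_one_eq_lintegral_enorm]
    exact eLpNorm_le_eLpNorm_of_exponent_le hp (hh.restrict.smul_measure _)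
  calc ‖⨍ y in t, h y ∂μ‖ₑ ^ p.toReal * μ t
      ≤ eLpNorm h p ((μ t)⁻¹ • μ.restrict t) ^ p.toReal * μ t := by gcongr
    _ = (μ t)⁻¹ * (∫⁻ y in t, ‖h y‖ₑ ^ p.toReal ∂μ) * μ t := by
        rw [eLpNorm_eq_lintegral_rpow_enorm_toReal hp0 hp_top, ← ENNReal.rpow_mul,
          one_div_mul_cancel (ENNReal.toReal_pos hp0 hp_top).ne', ENNReal.rpow_one,
          lintegral_smul_measure, smul_eq_mul]
    _ = ∫⁻ y in t, ‖h y‖ₑ ^ p.toReal ∂μ := by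
        rw [mul_right_comm, ENNReal.inv_mul_cancel h0 (measure_ne_top μ t), one_mul]

theorem eLpNorm_partAvg_le (hp : 1 ≤ p) (hp_top : p ≠ ∞) (hs : ∀ i, MeasurableSet (s i))
    (hd : Pairwise (Function.onFun Disjoint s)) {h : X → ℝ} (hh : AEStronglyMeasurable h μ) :
    eLpNorm (partAvg μ s h) p μ ≤ eLpNorm h p μ := by
  have hp0 : p ≠ 0 := (zero_lt_one.trans_le hp).ne'
  have hG : ‖(0 : ℝ)‖ₑ ^ p.toReal = 0 := by simp [ENNReal.toReal_pos hp0 hp_top]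
  rw [eLpNorm_eq_lintegral_rpow_enorm_toReal hp0 hp_top,
    eLpNorm_eq_lintegral_rpow_enorm_toReal hp0 hp_top]
  refine ENNReal.rpow_le_rpow ?_ (by positivity)
  calc ∫⁻ x, ‖partAvg μ s h x‖ₑ ^ p.toReal ∂μ
      = ∑ i, ‖⨍ y in s i, h y ∂μ‖ₑ ^ p.toReal * μ (s i) := by
        simp only [partAvg, map_partitionStep hd (G := fun z : ℝ => ‖z‖ₑ ^ p.toReal) hG,
          lintegral_partitionStep hs, Function.comp_apply]
    _ ≤ ∑ i, ∫⁻ y in s i, ‖h y‖ₑ ^ p.toReal ∂μ :=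
        Finset.sum_le_sum fun i _ => enorm_setAverage_rpow_mul_le hp hp_top hh
    _ = ∫⁻ y in ⋃ i, s i, ‖h y‖ₑ ^ p.toReal ∂μ := by
        rw [lintegral_iUnion hs hd, tsum_fintype]
    _ ≤ ∫⁻ y, ‖h y‖ₑ ^ p.toReal ∂μ := setLIntegral_le_lintegral _ _

end Partitions

section VanishingMesh

variable {X : Type*} [PseudoMetricSpace X] [MeasurableSpace X] {ι : ℕ → Type*} {μ : Measure X}
  {s : (n : ℕ) → ι n → Set X}

/-- A sequence of partitions, up to null sets, into sets of positive measure whose diameters tend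
to zero uniformly. -/
structure IsVanishingMesh (μ : Measure X) (s : (n : ℕ) → ι n → Set X) : Prop where
  measurableSet : ∀ n i, MeasurableSet (s n i)
  disjoint : ∀ n, Pairwise (Function.onFun Disjoint (s n))
  cover : ∀ᶠ n in atTop, ∀ᵐ x ∂μ, ∃ i, x ∈ s n i
  measure_ne_zero : ∀ n i, μ (s n i) ≠ 0
  dist_le : ∀ δ : ℝ, 0 < δ → ∀ᶠ n in atTop, ∀ i, ∀ x ∈ s n i, ∀ y ∈ s n i, dist x y < δ

namespace IsVanishingMesh

variable [∀ n, Fintype (ι n)]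

theorem aestronglyMeasurable_partAvg (hs : IsVanishingMesh μ s) (n : ℕ) (h : X → ℝ) :
    AEStronglyMeasurable (partAvg μ (s n) h) μ :=
  (measurable_partitionStep (hs.measurableSet n) _).aestronglyMeasurable

variable [IsFiniteMeasure μ] {p : ℝ≥0∞}

theorem tendsto_partAvg_of_uniformContinuous (hs : IsVanishingMesh μ s) {c : X → ℝ}
    (hc : UniformContinuous c) (hc_int : Integrable c μ) :
    Tendsto (fun n => eLpNorm (partAvg μ (s n) c - c) p μ) atTop (𝓝 0) := by
  have hbound : ∀ η : ℝ, 0 < η → ∀ᶠ n in atTop,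
      eLpNorm (partAvg μ (s n) c - c) p μ ≤ μ univ ^ p.toReal⁻¹ * ENNReal.ofReal η := by
    intro η hη
    obtain ⟨δ, hδ, hδη⟩ := Metric.uniformContinuous_iff.1 hc η hη
    filter_upwards [hs.dist_le δ hδ, hs.cover] with n hmesh hcover
    refine eLpNorm_le_of_ae_bound (hcover.mono fun x ⟨i, hi⟩ => ?_)
    rw [Pi.sub_apply, partAvg, partitionStep_of_mem (hs.disjoint n) hi, ← dist_eq_norm]
    refine (convex_closedBall (c x) η).set_average_mem Metric.isClosed_closedBall
      (hs.measure_ne_zero n i) (measure_ne_top μ _) ?_ hc_int.integrableOn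
    filter_upwards [ae_restrict_mem (hs.measurableSet n i)] with y hy
    exact (hδη (hmesh i y hy x hi)).le
  have hη_lim : Tendsto (fun η : ℝ => μ univ ^ p.toReal⁻¹ * ENNReal.ofReal η) (𝓝[>] 0) (𝓝 0) := by
    have := ENNReal.Tendsto.const_mul (a := μ univ ^ p.toReal⁻¹)
      (ENNReal.continuous_ofReal.tendsto 0) (Or.inr (by finiteness))
    simpa using this.mono_left nhdsWithin_le_nhds
  refine ENNReal.tendsto_nhds_zero.2 fun ε hε => ?_
  obtain ⟨η, hηε, hη⟩ := ((ENNReal.tendsto_nhds_zero.1 hη_lim ε hε).and self_mem_nhdsWithin).exists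
  exact (hbound η hη).mono fun n hn => hn.trans hηε

theorem tendsto_partAvg [ProperSpace X] [BorelSpace X] [μ.Regular] (hs : IsVanishingMesh μ s)
    (hp : 1 ≤ p) (hp_top : p ≠ ∞) {h : X → ℝ} (hh : MemLp h p μ) :
    Tendsto (fun n => eLpNorm (partAvg μ (s n) h - h) p μ) atTop (𝓝 0) := by
  refine ENNReal.tendsto_nhds_zero.2 fun ε hε => ?_
  obtain ⟨c, hc_supp, hc_near, hc_cont, hc⟩ := hh.exists_hasCompactSupport_eLpNorm_sub_le hp_top
    (ENNReal.div_pos hε.ne' (by norm_num) : 0 < ε / 3).ne'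
  have hc_lim := hs.tendsto_partAvg_of_uniformContinuous (p := p)
    (hc_supp.uniformContinuous_of_continuous hc_cont) (hc.integrable hp)
  filter_upwards [ENNReal.tendsto_nhds_zero.1 hc_lim (ε / 3)
    (ENNReal.div_pos hε.ne' (by norm_num))] with n hn
  have hsplit : partAvg μ (s n) h - h =
      partAvg μ (s n) (h - c) + (partAvg μ (s n) c - c) + (c - h) := by
    rw [partAvg_sub (hh.integrable hp) (hc.integrable hp)]
    abel
  have hm := hs.aestronglyMeasurable_partAvg n
  rw [hsplit, ← ENNReal.add_thirds ε]
  refine (eLpNorm_add_le ((hm _).add ((hm _).sub hc.1)) (hc.1.sub hh.1) hp).trans ?_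
  gcongr
  · refine (eLpNorm_add_le (hm _) ((hm _).sub hc.1) hp).trans ?_
    gcongr
    exact (eLpNorm_partAvg_le hp hp_top (hs.measurableSet n) (hs.disjoint n)
      (hh.1.sub hc.1)).trans hc_near
  · rwa [eLpNorm_sub_comm]

theorem tendsto_partAvg_of_tendsto [ProperSpace X] [BorelSpace X] [μ.Regular]
    (hs : IsVanishingMesh μ s) (hp : 1 ≤ p) (hp_top : p ≠ ∞) {h : X → ℝ} (hh : MemLp h p μ)
    {h' : ℕ → X → ℝ} (hh' : ∀ n, MemLp (h' n) p μ)
    (hlim : Tendsto (fun n => eLpNorm (h' n - h) p μ) atTop (𝓝 0)) :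
    Tendsto (fun n => eLpNorm (partAvg μ (s n) (h' n) - h) p μ) atTop (𝓝 0) := by
  refine tendsto_of_tendsto_of_tendsto_of_le_of_le tendsto_const_nhds
    (by simpa using hlim.add (hs.tendsto_partAvg hp hp_top hh)) (fun _ => zero_le) fun n => ?_
  have hsplit : partAvg μ (s n) (h' n) - h =
      partAvg μ (s n) (h' n - h) + (partAvg μ (s n) h - h) := by
    rw [partAvg_sub ((hh' n).integrable hp) (hh.integrable hp)]
    abel
  have hm := hs.aestronglyMeasurable_partAvg n
  rw [hsplit]
  refine (eLpNorm_add_le (hm _) ((hm _).sub hh.1) hp).trans ?_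
  gcongr
  exact eLpNorm_partAvg_le hp hp_top (hs.measurableSet n) (hs.disjoint n) ((hh' n).1.sub hh.1)

end IsVanishingMesh

end VanishingMesh

section Convergence

theorem tendsto_of_eventually_lipschitzWith {α E F : Type*} [PseudoMetricSpace E]
    [PseudoMetricSpace F] {l : Filter α} {G : α → E → F} {A : ℝ≥0}
    (hG : ∀ᶠ a in l, LipschitzWith A (G a)) {p q : α → E} {y : F}
    (hpq : Tendsto (fun a => dist (p a) (q a)) l (𝓝 0))
    (hp : Tendsto (fun a => G a (p a)) l (𝓝 y)) : Tendsto (fun a => G a (q a)) l (𝓝 y) := by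
  refine hp.congr_dist (squeeze_zero' (Eventually.of_forall fun _ => dist_nonneg)
    (hG.mono fun a ha => ha.dist_le_mul _ _) ?_)
  simpa using hpq.const_mul (A : ℝ)

theorem tendstoUniformlyOn_of_eventually_lipschitzWith {α E F : Type*} [PseudoMetricSpace E]
    [PseudoMetricSpace F] {l : Filter α} {G : α → E → F} {G₀ : E → F} {A : ℝ≥0}
    (hG : ∀ᶠ a in l, LipschitzWith A (G a)) (hG₀ : LipschitzWith A G₀) {S : Set E}
    (hS : Dense S) (hGS : ∀ s ∈ S, Tendsto (fun a => G a s) l (𝓝 (G₀ s))) {Q : Set E}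
    (hQ : IsCompact Q) : TendstoUniformlyOn G G₀ l Q := by
  rw [← tendstoLocallyUniformlyOn_iff_tendstoUniformlyOn_of_compact hQ]
  refine Metric.tendstoLocallyUniformlyOn_iff.2 fun ε hε x _ => ?_
  set δ : ℝ := ε / (4 * (A + 1)) with hδ_def
  have hδ : 0 < δ := by positivity
  have hAδ : A * δ ≤ ε / 4 := by
    rw [hδ_def, mul_div_assoc', div_le_iff₀ (by positivity)]
    nlinarith [A.coe_nonneg]
  obtain ⟨s, hsS, hxs⟩ := hS.exists_dist_lt x hδ
  refine ⟨Metric.ball s δ, mem_nhdsWithin_of_mem_nhds (Metric.isOpen_ball.mem_nhds hxs), ?_⟩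
  filter_upwards [hG, Metric.tendsto_nhds.1 (hGS s hsS) (ε / 2) (by positivity)] with a ha has y hy
  have hlip : ∀ {H : E → F}, LipschitzWith A H → dist (H y) (H s) ≤ ε / 4 := fun hH =>
    (hH.dist_le_mul _ _).trans ((by gcongr; exact (Metric.mem_ball.1 hy).le : _ ≤ A * δ).trans hAδ)
  have htri := dist_triangle4 (G₀ y) (G₀ s) (G a s) (G a y)
  rw [dist_comm (G₀ s), dist_comm (G a s) (G a y)] at htri
  linarith [hlip ha, hlip hG₀]

theorem eventually_gronwallBound_lt (A T : ℝ) {ε : ℝ} (hε : 0 < ε) :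
    ∀ᶠ η in 𝓝 (0 : ℝ), gronwallBound η A η T < ε := by
  have hcont : Continuous fun η => gronwallBound η A η T := by
    unfold gronwallBound
    split_ifs <;> fun_prop
  refine hcont.tendsto 0 |>.eventually_lt_const ?_
  rwa [gronwallBound_ε0_δ0]

variable {E : Type*} [NormedAddCommGroup E]

theorem exists_isGreatest_norm_sub_tendsto_zero {Y : Type*} [TopologicalSpace Y] {x : ℕ → Y → E}
    {u : Y → E} {Q : Set Y} (hQ : IsCompact Q) (hQ₀ : Q.Nonempty) (hx : ∀ n, ContinuousOn (x n) Q)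
    (hu : ContinuousOn u Q) (hxu : TendstoUniformlyOn x u atTop Q) :
    ∃ M : ℕ → ℝ, (∀ n, IsGreatest ((fun t => ‖x n t - u t‖) '' Q) (M n)) ∧
      Tendsto M atTop (𝓝 0) := by
  have hmax : ∀ n, ∃ M, IsGreatest ((fun t => ‖x n t - u t‖) '' Q) M := fun n =>
    (hQ.image_of_continuousOn ((hx n).sub hu).norm).exists_isGreatest (hQ₀.image _)
  choose M hM using hmax
  refine ⟨M, hM, Metric.tendsto_nhds.2 fun ε hε => ?_⟩
  filter_upwards [Metric.tendstoUniformlyOn_iff.1 hxu ε hε] with n hn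
  obtain ⟨t, ht, hMt⟩ := (hM n).1
  rw [← hMt, Real.dist_eq, sub_zero, abs_norm, ← dist_eq_norm, dist_comm]
  exact hn t ht

variable [NormedSpace ℝ E]

theorem tendstoUniformlyOn_of_consistent {G : ℕ → ℝ → E → E} {A : ℝ≥0}
    (hG : ∀ᶠ n in atTop, ∀ t, LipschitzWith A (G n t)) {x : ℕ → ℝ → E}
    (hx : ∀ᶠ n in atTop, ∀ t, HasDerivAt (x n) (G n t (x n t)) t) {u u' : ℝ → E}
    (hu : ∀ t, HasDerivAt u (u' t) t) (h0 : Tendsto (fun n => x n 0) atTop (𝓝 (u 0))) {T : ℝ}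
    (hcons : TendstoUniformlyOn (fun n t => G n t (u t)) u' atTop (Icc 0 T)) :
    TendstoUniformlyOn x u atTop (Icc 0 T) := by
  refine Metric.tendstoUniformlyOn_iff.2 fun ε hε => ?_
  obtain ⟨η, hηε, hη⟩ :=
    ((eventually_gronwallBound_lt A T hε).filter_mono nhdsWithin_le_nhds |>.and
      self_mem_nhdsWithin : ∀ᶠ η in 𝓝[>] (0 : ℝ), _ ∧ η ∈ Ioi 0).exists
  filter_upwards [hG, hx, Metric.tendsto_nhds.1 h0 η hη, Metric.tendstoUniformlyOn_iff.1 hcons η hη]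
    with n hLip hode hini hη_cons t ht
  have hgronwall := dist_le_of_approx_trajectories_ODE (εf := 0) hLip
    (fun t _ => (hode t).continuousAt.continuousWithinAt)
    (fun t _ => (hode t).hasDerivWithinAt) (fun t _ => (dist_self _).le)
    (fun t _ => (hu t).continuousAt.continuousWithinAt) (fun t _ => (hu t).hasDerivWithinAt)
    (fun t ht => (hη_cons t (Ico_subset_Icc_self ht)).le) hini.le t ht
  rw [zero_add, sub_zero, dist_comm] at hgronwall
  exact hgronwall.trans_lt
    ((gronwallBound_mono (le_of_lt hη) (le_of_lt hη) A.coe_nonneg ht.2).trans_lt hηε)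

theorem tendstoUniformlyOn_of_dense_consistent {Φ : ℝ → E → E} {A A' : ℝ≥0}
    (hΦ : ∀ t, LipschitzWith A (Φ t)) {G : ℕ → E → E} {G₀ : E → E}
    (hG : ∀ᶠ n in atTop, LipschitzWith A' (G n)) (hG₀ : LipschitzWith A' G₀)
    {S : Set E} (hS : Dense S) (hGS : ∀ s ∈ S, Tendsto (fun n => G n s) atTop (𝓝 (G₀ s)))
    {x : ℕ → ℝ → E} (hx : ∀ᶠ n in atTop, ∀ t, HasDerivAt (x n) (Φ t (x n t) + G n (x n t)) t)
    {u : ℝ → E} (hu : ∀ t, HasDerivAt u (Φ t (u t) + G₀ (u t)) t)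
    (h0 : Tendsto (fun n => x n 0) atTop (𝓝 (u 0))) (T : ℝ) :
    TendstoUniformlyOn x u atTop (Icc 0 T) := by
  refine tendstoUniformlyOn_of_consistent (G := fun n t ξ => Φ t ξ + G n ξ)
    (hG.mono fun n hn t => (hΦ t).add hn) hx hu h0 ?_
  have hu_cont : Continuous u := continuous_iff_continuousAt.2 fun t => (hu t).continuousAt
  have horbit := tendstoUniformlyOn_of_eventually_lipschitzWith hG hG₀ hS hGS
    ((isCompact_Icc (a := 0) (b := T)).image hu_cont)
  refine Metric.tendstoUniformlyOn_iff.2 fun ε hε => ?_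
  filter_upwards [Metric.tendstoUniformlyOn_iff.1 horbit ε hε] with n hn t ht
  rw [dist_add_left]
  exact hn (u t) (mem_image_of_mem u ht)

end Convergence

section Cells

theorem cell_subset_Icc (n : ℕ) (i : Fin n) : cell n i ⊆ Icc (0 : ℝ) 1 := by
  have hn : (0 : ℝ) < n := by exact_mod_cast i.pos
  have hi : (i : ℝ) + 1 ≤ n := by exact_mod_cast i.isLt
  have h0 : (0 : ℝ) ≤ (i : ℝ) / n := by positivity
  have h1 : ((i : ℝ) + 1) / n ≤ 1 := (div_le_one hn).2 hi
  intro x hx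
  unfold cell at hx
  split_ifs at hx
  · exact ⟨h0.trans hx.1, hx.2.le.trans h1⟩
  · exact ⟨h0.trans hx.1, hx.2.trans h1⟩

theorem cell_subset_Icc_div (n : ℕ) (i : Fin n) :
    cell n i ⊆ Icc ((i : ℝ) / n) (((i : ℝ) + 1) / n) := by
  unfold cell
  split_ifs
  · exact Ico_subset_Icc_self
  · exact subset_rfl

theorem dist_le_of_mem_cell {n : ℕ} {i : Fin n} {x y : ℝ} (hx : x ∈ cell n i)
    (hy : y ∈ cell n i) : dist x y ≤ 1 / n := by
  have h := Real.dist_le_of_mem_Icc (cell_subset_Icc_div n i hx) (cell_subset_Icc_div n i hy)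
  have : ((i : ℝ) + 1) / n - (i : ℝ) / n = 1 / n := by ring
  rwa [this] at h

theorem volume_cell (n : ℕ) (i : Fin n) : volume (cell n i) = ENNReal.ofReal (1 / n) := by
  have : ((i : ℝ) + 1) / n - (i : ℝ) / n = 1 / n := by ring
  unfold cell
  split_ifs
  · rw [Real.volume_Ico, this]
  · rw [Real.volume_Icc, this]

theorem restrict_cell (n : ℕ) (i : Fin n) : μI.restrict (cell n i) = volume.restrict (cell n i) :=
  Measure.restrict_restrict_of_subset (cell_subset_Icc n i)

theorem measure_cell (n : ℕ) (i : Fin n) : μI (cell n i) = ENNReal.ofReal (1 / n) := by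
  rw [Measure.restrict_apply (measurableSet_cell n i),
    inter_eq_self_of_subset_left (cell_subset_Icc n i), volume_cell]

theorem measureReal_cell (n : ℕ) (i : Fin n) : μI.real (cell n i) = 1 / n := by
  rw [measureReal_def, measure_cell, ENNReal.toReal_ofReal (by positivity)]

theorem disjoint_cell_of_lt {n : ℕ} {i j : Fin n} (h : i < j) :
    Disjoint (cell n i) (cell n j) := by
  have hn : (0 : ℝ) < n := by exact_mod_cast i.pos
  have hij : (i : ℝ) + 1 ≤ j := by exact_mod_cast h
  have hi : (i : ℕ) + 1 < n := lt_of_le_of_lt (Nat.succ_le_of_lt h) j.isLt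
  refine Set.disjoint_left.2 fun x hx hx' => ?_
  rw [cell, if_pos hi] at hx
  have h1 := (cell_subset_Icc_div n j hx').1
  have h2 : ((i : ℝ) + 1) / n ≤ j / n := by gcongr
  exact absurd hx.2 (not_lt.2 (h2.trans h1))

theorem pairwise_disjoint_cell (n : ℕ) : Pairwise (Function.onFun Disjoint (cell n)) := by
  intro i j hij
  rcases lt_or_gt_of_ne hij with h | h
  · exact disjoint_cell_of_lt h
  · exact (disjoint_cell_of_lt h).symm

theorem exists_mem_cell {n : ℕ} (hn : 0 < n) {x : ℝ} (hx : x ∈ Icc (0 : ℝ) 1) :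
    ∃ i, x ∈ cell n i := by
  have hn' : (0 : ℝ) < n := by exact_mod_cast hn
  have hfl := Nat.floor_le (mul_nonneg hn'.le hx.1)
  have hlt := Nat.lt_floor_add_one ((n : ℝ) * x)
  by_cases h : ⌊(n : ℝ) * x⌋₊ + 1 < n
  · refine ⟨⟨⌊(n : ℝ) * x⌋₊, by omega⟩, ?_⟩
    rw [cell, if_pos h]
    exact ⟨(div_le_iff₀ hn').2 (by linarith), (lt_div_iff₀ hn').2 (by linarith)⟩
  · refine ⟨⟨n - 1, by omega⟩, ?_⟩
    have hle : (n - 1 : ℕ) ≤ ⌊(n : ℝ) * x⌋₊ := by omega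
    have hc : ((n - 1 : ℕ) : ℝ) = n - 1 := by rw [Nat.cast_sub hn]; simp
    have hle' : ((n - 1 : ℕ) : ℝ) ≤ ⌊(n : ℝ) * x⌋₊ := by exact_mod_cast hle
    rw [cell, if_neg (by simp; omega)]
    refine ⟨(div_le_iff₀ hn').2 (by simp only; linarith), (le_div_iff₀ hn').2 ?_⟩
    simp only [hc]
    nlinarith [hx.2]

theorem measure_cell_ne_zero (n : ℕ) (i : Fin n) : μI (cell n i) ≠ 0 := by
  rw [measure_cell]
  simp [i.pos.ne']

theorem ae_exists_mem_cell {n : ℕ} (hn : 0 < n) : ∀ᵐ x ∂μI, ∃ i, x ∈ cell n i := by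
  filter_upwards [ae_restrict_mem measurableSet_Icc] with x hx
  exact exists_mem_cell hn hx

theorem isVanishingMesh_cell : IsVanishingMesh μI cell where
  measurableSet := measurableSet_cell
  disjoint := pairwise_disjoint_cell
  cover := (eventually_gt_atTop 0).mono fun _ hn => ae_exists_mem_cell hn
  measure_ne_zero := measure_cell_ne_zero
  dist_le δ hδ := by
    filter_upwards [tendsto_one_div_atTop_nhds_zero_nat.eventually_lt_const hδ]
      with n hn i x hx y hy
    exact (dist_le_of_mem_cell hx hy).trans_lt hn

/-- The cells of the product mesh of `I²`. -/
def cellProd (n : ℕ) (e : Fin n × Fin n) : Set (ℝ × ℝ) := cell n e.1 ×ˢ cell n e.2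

theorem measureReal_cellProd (n : ℕ) (e : Fin n × Fin n) :
    (μI.prod μI).real (cellProd n e) = 1 / (n : ℝ) ^ 2 := by
  rw [cellProd, measureReal_prod_prod, measureReal_cell, measureReal_cell]
  ring

theorem prod_restrict_cellProd (n : ℕ) (e : Fin n × Fin n) :
    (μI.prod μI).restrict (cellProd n e) = volume.restrict (cellProd n e) := by
  rw [cellProd, ← Measure.prod_restrict, restrict_cell, restrict_cell, Measure.prod_restrict]
  rfl

theorem ae_exists_mem_cellProd {n : ℕ} (hn : 0 < n) :
    ∀ᵐ p ∂(μI.prod μI), ∃ e, p ∈ cellProd n e := by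
  filter_upwards [Measure.quasiMeasurePreserving_fst.ae (ae_exists_mem_cell hn),
    Measure.quasiMeasurePreserving_snd.ae (ae_exists_mem_cell hn)] with p ⟨i, hi⟩ ⟨j, hj⟩
  exact ⟨(i, j), hi, hj⟩

theorem pairwise_disjoint_cellProd (n : ℕ) :
    Pairwise (Function.onFun Disjoint (cellProd n)) := by
  rintro ⟨i, j⟩ ⟨i', j'⟩ h
  rw [Function.onFun, cellProd, cellProd, Set.disjoint_prod]
  by_cases hi : i = i'
  · exact Or.inr (pairwise_disjoint_cell n fun hj => h (Prod.ext hi hj))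
  · exact Or.inl (pairwise_disjoint_cell n hi)

theorem isVanishingMesh_cellProd : IsVanishingMesh (μI.prod μI) cellProd where
  measurableSet n e := (measurableSet_cell n e.1).prod (measurableSet_cell n e.2)
  disjoint := pairwise_disjoint_cellProd
  cover := (eventually_gt_atTop 0).mono fun _ hn => ae_exists_mem_cellProd hn
  measure_ne_zero n e := by
    rw [cellProd, Measure.prod_prod]
    exact mul_ne_zero (measure_cell_ne_zero n _) (measure_cell_ne_zero n _)
  dist_le δ hδ := by
    filter_upwards [isVanishingMesh_cell.dist_le δ hδ] with n hn e p hp q hq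
    exact max_lt (hn e.1 _ hp.1 _ hq.1) (hn e.2 _ hp.2 _ hq.2)

end Cells

section StepFunctions

theorem coeFn_stepLp (n : ℕ) (v : Fin n → ℝ) : stepLp n v =ᵐ[μI] partitionStep (cell n) v := by
  have h : ∀ i, (v i • indicatorConstLp 2 (measurableSet_cell n i) (measure_ne_top μI _) (1 : ℝ) :
      L2I) =ᵐ[μI] (cell n i).indicator (fun _ => v i) := by
    intro i
    filter_upwards [Lp.coeFn_smul (v i)
        (indicatorConstLp 2 (measurableSet_cell n i) (measure_ne_top μI _) (1 : ℝ)),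
      indicatorConstLp_coeFn (p := 2) (hs := measurableSet_cell n i)
        (hμs := measure_ne_top μI _) (c := (1 : ℝ))] with x h1 h2
    rw [h1, Pi.smul_apply, h2]
    by_cases hx : x ∈ cell n i <;> simp [hx]
  filter_upwards [Lp.coeFn_fun_finsetSum Finset.univ fun i =>
      (v i • indicatorConstLp 2 (measurableSet_cell n i) (measure_ne_top μI _) (1 : ℝ) : L2I),
    ae_all_iff.2 h] with x h1 h2
  rw [stepLp, h1, partitionStep]
  exact Finset.sum_congr rfl fun i _ => h2 i

theorem stepLp_add (n : ℕ) (v w : Fin n → ℝ) : stepLp n (v + w) = stepLp n v + stepLp n w := by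
  simp only [stepLp, Pi.add_apply, add_smul, Finset.sum_add_distrib]

theorem stepLp_sub (n : ℕ) (v w : Fin n → ℝ) : stepLp n (v - w) = stepLp n v - stepLp n w := by
  simp only [stepLp, Pi.sub_apply, sub_smul, Finset.sum_sub_distrib]

theorem stepLp_sum {κ : Type*} (s : Finset κ) (n : ℕ) (v : κ → Fin n → ℝ) :
    stepLp n (∑ k ∈ s, v k) = ∑ k ∈ s, stepLp n (v k) := by
  simp only [stepLp, Finset.sum_apply, Finset.sum_smul]
  exact Finset.sum_comm

theorem norm_stepLp_le {n : ℕ} {v : Fin n → ℝ} {c : ℝ} (hc : 0 ≤ c) (h : ∀ i, |v i| ≤ c) :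
    ‖stepLp n v‖ ≤ c := by
  have hbound : ∀ᵐ x ∂μI, ‖stepLp n v x‖ ≤ c := by
    filter_upwards [coeFn_stepLp n v] with x hx
    rw [hx]
    by_cases hmem : ∃ i, x ∈ cell n i
    · obtain ⟨i, hi⟩ := hmem
      exact (partitionStep_of_mem (pairwise_disjoint_cell n) hi v).symm ▸ h i
    · push Not at hmem
      simpa [partitionStep, hmem] using hc
  simpa [measureUnivNNReal] using Lp.norm_le_of_ae_bound hc hbound

/-- The averages of `φ` over the cells. -/
def cellMean (n : ℕ) (φ : ℝ → ℝ) (i : Fin n) : ℝ := n * ∫ x in cell n i, φ x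

theorem partitionStep_cellMean (n : ℕ) (φ : ℝ → ℝ) :
    partitionStep (cell n) (cellMean n φ) = partAvg μI (cell n) φ := by
  refine congrArg _ (funext fun i => ?_)
  rw [setAverage_eq, measureReal_cell, restrict_cell, cellMean, one_div, inv_inv, smul_eq_mul]

theorem tendsto_stepLp_cellMean (φ : L2I) :
    Tendsto (fun n => stepLp n (cellMean n φ)) atTop (𝓝 φ) := by
  rw [Lp.tendsto_Lp_iff_tendsto_eLpNorm']
  refine (isVanishingMesh_cell.tendsto_partAvg one_le_two ENNReal.ofNat_ne_top
    (Lp.memLp φ)).congr fun n => eLpNorm_congr_ae ?_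
  filter_upwards [coeFn_stepLp n (cellMean n φ)] with x hx
  rw [Pi.sub_apply, Pi.sub_apply, hx, partitionStep_cellMean]

theorem nemytskiiL2_stepLp {n : ℕ} (hn : 0 < n) (F : ℝ → ℝ) (v : Fin n → ℝ) :
    nemytskiiL2 μI F (stepLp n v) = stepLp n (F ∘ v) := by
  refine toL2_eq ?_
  filter_upwards [coeFn_stepLp n v, coeFn_stepLp n (F ∘ v), ae_exists_mem_cell hn]
    with x hv hFv ⟨i, hi⟩
  rw [Function.comp_apply, hv, hFv, partitionStep_of_mem (pairwise_disjoint_cell n) hi,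
    partitionStep_of_mem (pairwise_disjoint_cell n) hi, Function.comp_apply]

end StepFunctions

section StepKernels

variable {n : ℕ}

/-- The kernel on `I²` with value `a i j` on the cell `(i, j)` of the product mesh. -/
def stepKernel (n : ℕ) (a : Fin n → Fin n → ℝ) : ℝ × ℝ → ℝ :=
  partitionStep (cellProd n) fun e => a e.1 e.2

theorem measurable_stepKernel (n : ℕ) (a : Fin n → Fin n → ℝ) : Measurable (stepKernel n a) :=
  measurable_partitionStep (isVanishingMesh_cellProd.measurableSet n) _

theorem stepKernel_of_mem {i j : Fin n} {x y : ℝ} (hx : x ∈ cell n i) (hy : y ∈ cell n j)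
    (a : Fin n → Fin n → ℝ) : stepKernel n a (x, y) = a i j :=
  partitionStep_of_mem (pairwise_disjoint_cellProd n) (i := (i, j)) (mk_mem_prod hx hy) _

/-- A weight matrix whose rows and columns have `ℓ¹`-norm at most `C n`, the discrete counterpart
of `IsSchurKernel`. -/
structure IsSchurMatrix (a : Fin n → Fin n → ℝ) (C : ℝ) : Prop where
  row : ∀ i, ∑ j, |a i j| ≤ C * n
  col : ∀ j, ∑ i, |a i j| ≤ C * n

theorem lintegral_enorm_partitionStep_cell_le {v : Fin n → ℝ} {C : ℝ≥0}
    (hv : ∑ j, |v j| ≤ C * n) : ∫⁻ y, ‖partitionStep (cell n) v y‖ₑ ∂μI ≤ C := by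
  simp only [map_partitionStep (pairwise_disjoint_cell n) (G := (‖·‖ₑ)) (enorm_zero (E := ℝ)),
    lintegral_partitionStep (measurableSet_cell n), measure_cell, Function.comp_apply,
    Real.enorm_eq_ofReal_abs]
  rw [← Finset.sum_mul, ← ENNReal.ofReal_sum_of_nonneg fun _ _ => abs_nonneg _,
    ← ENNReal.ofReal_mul (Finset.sum_nonneg fun _ _ => abs_nonneg _), ← ENNReal.ofReal_coe_nnreal]
  refine ENNReal.ofReal_le_ofReal ?_
  rw [mul_one_div]
  exact div_le_of_le_mul₀ n.cast_nonneg C.coe_nonneg hv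

theorem IsSchurMatrix.isSchurKernel_stepKernel (hn : 0 < n) {a : Fin n → Fin n → ℝ} {C : ℝ≥0}
    (ha : IsSchurMatrix a C) : IsSchurKernel μI (stepKernel n a) C where
  aestronglyMeasurable := (measurable_stepKernel n a).aestronglyMeasurable
  row := by
    filter_upwards [ae_exists_mem_cell hn] with x ⟨i, hi⟩
    refine (lintegral_mono_ae ?_).trans (lintegral_enorm_partitionStep_cell_le (ha.row i))
    filter_upwards [ae_exists_mem_cell hn] with y ⟨j, hj⟩
    rw [stepKernel_of_mem hi hj, partitionStep_of_mem (pairwise_disjoint_cell n) hj]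
  col := by
    filter_upwards [ae_exists_mem_cell hn] with y ⟨j, hj⟩
    refine (lintegral_mono_ae ?_).trans (lintegral_enorm_partitionStep_cell_le (ha.col j))
    filter_upwards [ae_exists_mem_cell hn] with x ⟨i, hi⟩
    rw [stepKernel_of_mem hi hj, partitionStep_of_mem (pairwise_disjoint_cell n) hi]

/-- The velocity of each node of a network with weight matrix `a` and coupling function `D`. -/
def networkInteraction (n : ℕ) (a : Fin n → Fin n → ℝ) (D : ℝ → ℝ) (v : Fin n → ℝ)
    (i : Fin n) : ℝ :=
  1 / n * ∑ j, a i j * D (v j - v i)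

theorem interactionL2_stepKernel (hn : 0 < n) (a : Fin n → Fin n → ℝ) (D : ℝ → ℝ)
    (v : Fin n → ℝ) :
    interactionL2 μI (stepKernel n a) D (stepLp n v) = stepLp n (networkInteraction n a D v) := by
  have hd := pairwise_disjoint_cell n
  refine toL2_eq ?_
  filter_upwards [coeFn_stepLp n v, coeFn_stepLp n (networkInteraction n a D v),
    ae_exists_mem_cell hn] with x hv hN ⟨i, hi⟩
  have hrow : (fun y => stepKernel n a (x, y) * D (stepLp n v y - v i)) =ᵐ[μI]
      partitionStep (cell n) fun j => a i j * D (v j - v i) := by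
    filter_upwards [coeFn_stepLp n v, ae_exists_mem_cell hn] with y hy ⟨j, hj⟩
    rw [hy, stepKernel_of_mem hi hj, partitionStep_of_mem hd hj, partitionStep_of_mem hd hj]
  rw [hN, partitionStep_of_mem hd hi, interaction, hv, partitionStep_of_mem hd hi,
    integral_congr_ae hrow, integral_partitionStep (measurableSet_cell n), networkInteraction,
    Finset.mul_sum]
  simp only [measureReal_cell]

theorem stepKernel_cellAvg (V : ℝ × ℝ → ℝ) (n : ℕ) :
    stepKernel n (cellAvg V n) = partAvg (μI.prod μI) (cellProd n) V := by
  refine congrArg (partitionStep (cellProd n)) (funext fun e => ?_)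
  rw [setAverage_eq, measureReal_cellProd, prod_restrict_cellProd, cellAvg, one_div, inv_inv,
    smul_eq_mul, cellProd]

theorem cellAvg_swap (V : ℝ × ℝ → ℝ) (i j : Fin n) :
    cellAvg (V ∘ Prod.swap) n i j = cellAvg V n j i := by
  rw [cellAvg, cellAvg]
  congr 1
  exact setIntegral_prod_swap (μ := (volume : Measure ℝ)) (ν := (volume : Measure ℝ)) _ _ V

theorem enorm_cellAvg_le (V : ℝ × ℝ → ℝ) (i j : Fin n) :
    ‖cellAvg V n i j‖ₑ ≤ (n : ℝ≥0∞) ^ 2 * ∫⁻ p in cellProd n (i, j), ‖V p‖ₑ ∂(μI.prod μI) := by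
  rw [cellAvg, enorm_mul, enorm_pow, Real.enorm_natCast, prod_restrict_cellProd]
  gcongr
  exact enorm_integral_le_lintegral_enorm _

theorem sum_abs_cellAvg_le {V : ℝ × ℝ → ℝ} {C : ℝ≥0} (hV : IsSchurKernel μI V C) (i : Fin n) :
    ∑ j, |cellAvg V n i j| ≤ C * n := by
  have hn : (n : ℝ≥0∞) ≠ 0 := by exact_mod_cast i.pos.ne'
  have hsum : ∑ j, ‖cellAvg V n i j‖ₑ ≤ (C * n : ℝ≥0∞) := by
    calc ∑ j, ‖cellAvg V n i j‖ₑ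
        ≤ ∑ j, (n : ℝ≥0∞) ^ 2 * ∫⁻ p in cellProd n (i, j), ‖V p‖ₑ ∂(μI.prod μI) :=
          Finset.sum_le_sum fun j _ => enorm_cellAvg_le V i j
      _ = (n : ℝ≥0∞) ^ 2 * ∫⁻ p in ⋃ j, cellProd n (i, j), ‖V p‖ₑ ∂(μI.prod μI) := by
          rw [← Finset.mul_sum,
            lintegral_iUnion (fun j => isVanishingMesh_cellProd.measurableSet n (i, j)),
            tsum_fintype]
          exact fun j j' h => pairwise_disjoint_cellProd n fun h' => h (Prod.ext_iff.1 h').2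
      _ ≤ (n : ℝ≥0∞) ^ 2 * ∫⁻ p in cell n i ×ˢ univ, ‖V p‖ₑ ∂(μI.prod μI) := by
          gcongr
          exact iUnion_subset fun j => prod_mono subset_rfl (subset_univ _)
      _ = (n : ℝ≥0∞) ^ 2 * ∫⁻ x in cell n i, ∫⁻ y, ‖V (x, y)‖ₑ ∂μI ∂μI := by
          rw [← Measure.prod_restrict, Measure.restrict_univ, lintegral_prod]
          refine hV.aestronglyMeasurable.enorm.mono_ac ?_
          exact Measure.AbsolutelyContinuous.prod Measure.restrict_le_self.absolutelyContinuous
            Measure.AbsolutelyContinuous.rfl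
      _ ≤ (n : ℝ≥0∞) ^ 2 * ∫⁻ _x in cell n i, C ∂μI := by
          gcongr 1
          exact lintegral_mono_ae (ae_restrict_of_ae hV.row)
      _ = C * n := by
          rw [setLIntegral_const, measure_cell, one_div, ENNReal.ofReal_inv_of_pos
            (by exact_mod_cast i.pos), ENNReal.ofReal_natCast, mul_left_comm, sq, mul_assoc,
            ENNReal.mul_inv_cancel hn (ENNReal.natCast_ne_top n), mul_one]
  have hreal := (ENNReal.toReal_le_toReal (ne_top_of_le_ne_top (by finiteness) hsum)
    (by finiteness)).2 hsum
  rw [ENNReal.toReal_sum fun _ _ => enorm_ne_top] at hreal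
  simpa using hreal

theorem IsSchurKernel.isSchurMatrix_cellAvg {V : ℝ × ℝ → ℝ} {C : ℝ≥0}
    (hV : IsSchurKernel μI V C) (n : ℕ) : IsSchurMatrix (cellAvg V n) C where
  row := sum_abs_cellAvg_le hV
  col j := by
    simp only [← cellAvg_swap V j]
    exact sum_abs_cellAvg_le hV.swap j

end StepKernels

section Concentration

variable {Ω ι : Type*} [MeasurableSpace Ω] {P : Measure Ω} [IsProbabilityMeasure P]

theorem mgf_bernoulli_sub_le {w : Ω → ℝ} (hm : Measurable w) (h01 : ∀ ω, w ω = 0 ∨ w ω = 1)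
    {p : ℝ} (hp : 0 ≤ p) (hP : P {ω | w ω = 1} = ENNReal.ofReal p) {a t : ℝ} (hat : |t * a| ≤ 1) :
    mgf (fun ω => a * (w ω - p)) P t ≤ Real.exp ((t * a) ^ 2 * p) := by
  set b := t * a with hb
  have hS : MeasurableSet {ω | w ω = 1} := hm (measurableSet_singleton 1)
  have hpt : ∀ ω, Real.exp (t * (a * (w ω - p))) =
      Real.exp (-(b * p)) * (1 + {ω | w ω = 1}.indicator (fun _ => Real.exp b - 1) ω) := by
    intro ω
    have h1 : t * (a * (w ω - p)) = -(b * p) + b * w ω := by rw [hb]; ring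
    rw [h1, Real.exp_add]
    rcases h01 ω with h | h <;> simp [indicator, h]
  have hmgf : mgf (fun ω => a * (w ω - p)) P t =
      Real.exp (-(b * p)) * (1 + p * (Real.exp b - 1)) := by
    simp only [mgf, hpt]
    rw [integral_const_mul, integral_add (integrable_const _)
      ((integrable_const _).indicator hS), integral_indicator_const _ hS, measureReal_def, hP,
      ENNReal.toReal_ofReal hp]
    simp
  have hexp : Real.exp b - 1 ≤ b + b ^ 2 := by
    linarith [(abs_le.1 (Real.abs_exp_sub_one_sub_id_le hat)).2]
  calc mgf (fun ω => a * (w ω - p)) P t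
      = Real.exp (-(b * p)) * (1 + p * (Real.exp b - 1)) := hmgf
    _ ≤ Real.exp (-(b * p)) * (p * (b + b ^ 2) + 1) := by
        rw [add_comm (p * (b + b ^ 2))]
        gcongr
    _ ≤ Real.exp (-(b * p)) * Real.exp (p * (b + b ^ 2)) := by
        gcongr
        exact Real.add_one_le_exp _
    _ = Real.exp (b ^ 2 * p) := by rw [← Real.exp_add]; ring_nf

/-- `w` is a family of independent Bernoulli variables, `w j` having success probability `p j`. -/
structure IsBernoulliFamily (P : Measure Ω) (w : ι → Ω → ℝ) (p : ι → ℝ) : Prop where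
  measurable : ∀ j, Measurable (w j)
  zero_or_one : ∀ j ω, w j ω = 0 ∨ w j ω = 1
  nonneg : ∀ j, 0 ≤ p j
  prob : ∀ j, P {ω | w j ω = 1} = ENNReal.ofReal (p j)
  indep : iIndepFun w P

namespace IsBernoulliFamily

variable [Fintype ι] {w : ι → Ω → ℝ} {p a : ι → ℝ} {B C r s t ε : ℝ}

theorem integrable_exp_mul_sum (h : IsBernoulliFamily P w p) (a : ι → ℝ) (t : ℝ) :
    Integrable (fun ω => Real.exp (t * ∑ j, a j * (w j ω - p j))) P := by
  have hm : Measurable fun ω => ∑ j, a j * (w j ω - p j) :=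
    Finset.measurable_fun_sum _ fun j _ => ((h.measurable j).sub_const _).const_mul _
  have hterm : ∀ j ω, |a j * (w j ω - p j)| ≤ |a j| * (1 + p j) := by
    intro j ω
    rw [abs_mul]
    gcongr
    rcases h.zero_or_one j ω with h' | h' <;> rw [h', abs_le] <;>
      constructor <;> linarith [h.nonneg j]
  refine Integrable.of_bound (C := Real.exp (|t| * ∑ j, |a j| * (1 + p j)))
    (hm.const_mul t).exp.aestronglyMeasurable (Eventually.of_forall fun ω => ?_)
  rw [Real.norm_eq_abs, Real.abs_exp]
  refine Real.exp_le_exp.2 ((le_abs_self _).trans ?_)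
  rw [abs_mul]
  gcongr
  exact (Finset.abs_sum_le_sum_abs _ _).trans (Finset.sum_le_sum fun j _ => hterm j ω)

theorem measureReal_sum_ge_le (h : IsBernoulliFamily P w p) (ht : 0 ≤ t) (htB : t * B ≤ 1)
    (ha : ∀ j, |a j| ≤ B) (r : ℝ) :
    P.real {ω | r ≤ ∑ j, a j * (w j ω - p j)} ≤
      Real.exp (-t * r + t ^ 2 * B ^ 2 * ∑ j, p j) := by
  have hta : ∀ j, |t * a j| ≤ t * B := fun j => by
    rw [abs_mul, abs_of_nonneg ht]; exact mul_le_mul_of_nonneg_left (ha j) ht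
  set X : ι → Ω → ℝ := fun j ω => a j * (w j ω - p j)
  have hXind : iIndepFun X P :=
    h.indep.comp (fun j y => a j * (y - p j)) fun j => (measurable_id.sub_const _).const_mul _
  have hmgf : ∀ j, mgf (X j) P t ≤ Real.exp (t ^ 2 * B ^ 2 * p j) := by
    intro j
    refine (mgf_bernoulli_sub_le (h.measurable j) (h.zero_or_one j) (h.nonneg j) (h.prob j)
      ((hta j).trans htB)).trans ?_
    gcongr
    · exact h.nonneg j
    · rw [← mul_pow]
      exact sq_le_sq.2 ((hta j).trans (le_abs_self _))
  calc P.real {ω | r ≤ ∑ j, X j ω}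
      = P.real {ω | r ≤ (∑ j, X j) ω} := by simp only [Finset.sum_apply]
    _ ≤ Real.exp (-t * r) * mgf (∑ j, X j) P t :=
        measure_ge_le_exp_mul_mgf r ht
          (by simpa only [Finset.sum_apply] using h.integrable_exp_mul_sum a t)
    _ = Real.exp (-t * r) * ∏ j, mgf (X j) P t := by
        rw [hXind.mgf_sum fun j => ((h.measurable j).sub_const _).const_mul _]
    _ ≤ Real.exp (-t * r) * ∏ j, Real.exp (t ^ 2 * B ^ 2 * p j) := by
        gcongr with j
        · exact fun j _ => mgf_nonneg
        · exact hmgf j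
    _ = Real.exp (-t * r + t ^ 2 * B ^ 2 * ∑ j, p j) := by
        rw [← Real.exp_sum, ← Finset.mul_sum, ← Real.exp_add]

theorem measureReal_abs_sum_ge_le (h : IsBernoulliFamily P w p) (ht : 0 ≤ t) (htB : t * B ≤ 1)
    (ha : ∀ j, |a j| ≤ B) (r : ℝ) :
    P.real {ω | r ≤ |∑ j, a j * (w j ω - p j)|} ≤
      2 * Real.exp (-t * r + t ^ 2 * B ^ 2 * ∑ j, p j) := by
  have hpos := h.measureReal_sum_ge_le ht htB ha r
  have hneg := h.measureReal_sum_ge_le (a := fun j => -a j) ht htB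
    (fun j => (abs_neg (a j)).trans_le (ha j)) r
  have hsub : {ω | r ≤ |∑ j, a j * (w j ω - p j)|} ⊆ {ω | r ≤ ∑ j, a j * (w j ω - p j)} ∪
      {ω | r ≤ ∑ j, -a j * (w j ω - p j)} := by
    intro ω hω
    simpa only [neg_mul, Finset.sum_neg_distrib, mem_union, mem_ofPred_eq, le_abs] using hω
  linarith [(measureReal_mono (μ := P) hsub).trans (measureReal_union_le _ _)]

theorem measureReal_abs_sum_ge_mul_le (h : IsBernoulliFamily P w p) (ht : 0 ≤ t)
    (htB : t * B ≤ 1) (ha : ∀ j, |a j| ≤ B) (hs : 0 ≤ s) (hps : ∑ j, p j ≤ C * s)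
    (htC : t * (B ^ 2 * C) ≤ ε / 2) :
    P.real {ω | ε * s ≤ |∑ j, a j * (w j ω - p j)|} ≤ 2 * Real.exp (-(t * (ε / 2)) * s) := by
  refine (h.measureReal_abs_sum_ge_le ht htB ha _).trans ?_
  gcongr
  calc -t * (ε * s) + t ^ 2 * B ^ 2 * ∑ j, p j
      ≤ -t * (ε * s) + t ^ 2 * B ^ 2 * (C * s) := by gcongr
    _ = -t * (ε * s) + t * (t * (B ^ 2 * C)) * s := by ring
    _ ≤ -t * (ε * s) + t * (ε / 2) * s := by gcongr
    _ = -(t * (ε / 2)) * s := by ring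

end IsBernoulliFamily

theorem exists_pos_mul_le_mul_le {x y b c : ℝ} (hx : 0 ≤ x) (hy : 0 ≤ y) (hb : 0 < b)
    (hc : 0 < c) : ∃ t > 0, t * x ≤ b ∧ t * y ≤ c := by
  refine ⟨min (b / (x + 1)) (c / (y + 1)), by positivity, ?_, ?_⟩
  · calc _ ≤ b / (x + 1) * (x + 1) := by gcongr <;> simp
      _ = b := by field_simp
  · calc _ ≤ c / (y + 1) * (y + 1) := by gcongr <;> simp
      _ = c := by field_simp

variable {w : (n : ℕ) → Fin n → Fin n → Ω → ℝ} {p a : (n : ℕ) → Fin n → Fin n → ℝ} {s : ℕ → ℝ}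
  {B C : ℝ}

theorem ae_eventually_abs_sum_le_mul (h : ∀ n i, IsBernoulliFamily P (w n i) (p n i))
    (hs : ∀ n, 0 ≤ s n) (hs_sum : ∀ c > 0, Summable fun n : ℕ => n * Real.exp (-c * s n))
    (hC : 0 ≤ C) (hpC : ∀ n i, ∑ j, p n i j ≤ C * s n) (hB : 0 ≤ B) (ha : ∀ n i j, |a n i j| ≤ B)
    {ε : ℝ} (hε : 0 < ε) :
    ∀ᵐ ω ∂P, ∀ᶠ n in atTop, ∀ i, |∑ j, a n i j * (w n i j ω - p n i j)| ≤ ε * s n := by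
  obtain ⟨t, ht, htB, htC⟩ :=
    exists_pos_mul_le_mul_le hB (y := B ^ 2 * C) (by positivity) one_pos (half_pos hε)
  set bad : (n : ℕ) → Fin n → Set Ω := fun n i =>
    {ω | ε * s n ≤ |∑ j, a n i j * (w n i j ω - p n i j)|}
  set c := t * (ε / 2)
  have hbad : ∀ n, P (⋃ i, bad n i) ≤ ENNReal.ofReal (2 * (n * Real.exp (-c * s n))) := by
    intro n
    rw [← ofReal_measureReal]
    refine ENNReal.ofReal_le_ofReal ((measureReal_iUnion_fintype_le _).trans ?_)
    refine (Finset.sum_le_sum fun i _ => (h n i).measureReal_abs_sum_ge_mul_le ht.le htB (ha n i)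
      (hs n) (hpC n i) htC).trans_eq ?_
    simp only [Finset.sum_const, Finset.card_univ, Fintype.card_fin, nsmul_eq_mul]
    ring
  have hsum : ∑' n, P (⋃ i, bad n i) ≠ ∞ :=
    ne_top_of_le_ne_top ((hs_sum c (by positivity)).mul_left 2).tsum_ofReal_ne_top
      (ENNReal.tsum_le_tsum hbad)
  filter_upwards [ae_eventually_notMem hsum] with ω hω
  filter_upwards [hω] with n hn i
  simp only [bad, mem_iUnion, mem_ofPred_eq, not_exists, not_le] at hn
  exact (hn i).le

/-- An array of constants `p`, or one whose rows are independent Bernoulli variables with success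
probabilities `p`: what deterministic and random graphs have in common. -/
def IsConstOrBernoulli (P : Measure Ω) (w : (n : ℕ) → Fin n → Fin n → Ω → ℝ)
    (p : (n : ℕ) → Fin n → Fin n → ℝ) : Prop :=
  (∀ n i j ω, w n i j ω = p n i j) ∨ ∀ n i, IsBernoulliFamily P (w n i) (p n i)

namespace IsConstOrBernoulli

theorem ae_forall_eventually_abs_sum_le_mul (h : IsConstOrBernoulli P w p) (hs : ∀ n, 0 ≤ s n)
    (hs_sum : ∀ c > 0, Summable fun n : ℕ => n * Real.exp (-c * s n))
    (hC : 0 ≤ C) (hpC : ∀ n i, ∑ j, |p n i j| ≤ C * s n) (hB : 0 ≤ B)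
    (ha : ∀ n i j, |a n i j| ≤ B) :
    ∀ᵐ ω ∂P, ∀ ε > 0, ∀ᶠ n in atTop, ∀ i,
      |∑ j, a n i j * (w n i j ω - p n i j)| ≤ ε * s n := by
  rcases h with hconst | hbernoulli
  · refine Eventually.of_forall fun ω ε hε => Eventually.of_forall fun n i => ?_
    simpa only [hconst, sub_self, mul_zero, Finset.sum_const_zero, abs_zero] using
      mul_nonneg hε.le (hs n)
  · have hpC' : ∀ n i, ∑ j, p n i j ≤ C * s n := fun n i =>
      (Finset.sum_le_sum fun j _ => le_abs_self _).trans (hpC n i)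
    have hseq : ∀ᵐ ω ∂P, ∀ l : ℕ, ∀ᶠ n in atTop, ∀ i,
        |∑ j, a n i j * (w n i j ω - p n i j)| ≤ 1 / ((l : ℝ) + 1) * s n :=
      ae_all_iff.2 fun l =>
        ae_eventually_abs_sum_le_mul hbernoulli hs hs_sum hC hpC' hB ha (by positivity)
    filter_upwards [hseq] with ω hω ε hε
    obtain ⟨l, hl⟩ := exists_nat_one_div_lt hε
    filter_upwards [hω l] with n hn i
    exact (hn i).trans (mul_le_mul_of_nonneg_right hl.le (hs n))

theorem ae_eventually_sum_abs_le (h : IsConstOrBernoulli P w p) (hs : ∀ n, 0 ≤ s n)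
    (hs_sum : ∀ c > 0, Summable fun n : ℕ => n * Real.exp (-c * s n))
    (hC : 0 ≤ C) (hpC : ∀ n i, ∑ j, |p n i j| ≤ C * s n) :
    ∀ᵐ ω ∂P, ∀ᶠ n in atTop, ∀ i, ∑ j, |w n i j ω| ≤ (C + 1) * s n := by
  filter_upwards [h.ae_forall_eventually_abs_sum_le_mul hs hs_sum hC hpC
    (a := fun _ _ _ => 1) zero_le_one (by simp)] with ω hω
  filter_upwards [hω 1 one_pos] with n hn i
  simp only [one_mul] at hn
  have hle : ∀ j, |w n i j ω| ≤ w n i j ω - p n i j + |p n i j| := by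
    intro j
    rcases h with hconst | hbernoulli
    · simp [hconst]
    · rw [abs_of_nonneg ((hbernoulli n i).nonneg j), sub_add_cancel]
      rcases (hbernoulli n i).zero_or_one j ω with h | h <;> simp [h]
  calc ∑ j, |w n i j ω| ≤ ∑ j, (w n i j ω - p n i j + |p n i j|) :=
        Finset.sum_le_sum fun j _ => hle j
    _ = ∑ j, (w n i j ω - p n i j) + ∑ j, |p n i j| := Finset.sum_add_distrib
    _ ≤ (C + 1) * s n := by linarith [le_of_abs_le (hn i), hpC n i]

end IsConstOrBernoulli

end Concentration

section Scaling

theorem summable_mul_exp_neg_rpow {c β : ℝ} (hc : 0 < c) (hβ : 0 < β) :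
    Summable fun n : ℕ => (n : ℝ) * Real.exp (-c * (n : ℝ) ^ β) := by
  have hexp : (fun n : ℕ => Real.exp (-c * (n : ℝ) ^ β)) =o[atTop]
      fun n : ℕ => ((n : ℝ) ^ β) ^ (-3 / β) :=
    (isLittleO_exp_neg_mul_rpow_atTop hc (-3 / β)).comp_tendsto
      ((tendsto_rpow_atTop hβ).comp tendsto_natCast_atTop_atTop)
  have hpow : (fun n : ℕ => (n : ℝ) * ((n : ℝ) ^ β) ^ (-3 / β)) =ᶠ[atTop]
      fun n : ℕ => (n : ℝ) ^ (-2 : ℝ) := by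
    filter_upwards [eventually_gt_atTop 0] with n hn
    have hn' : (0 : ℝ) < n := by exact_mod_cast hn
    rw [← Real.rpow_mul hn'.le, mul_div_cancel₀ _ hβ.ne', ← Real.rpow_one_add' hn'.le (by norm_num)]
    norm_num
  exact summable_of_isBigO_nat (Real.summable_nat_rpow.2 (by norm_num))
    (((Asymptotics.isBigO_refl _ _).mul hexp.isBigO).trans hpow.isBigO)

theorem scaling_nonneg (γ : ℝ) (n : ℕ) : 0 ≤ scaling γ n := by unfold scaling; positivity

theorem scaling_pos (γ : ℝ) {n : ℕ} (hn : 0 < n) : 0 < scaling γ n := by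
  unfold scaling; positivity

theorem scaling_zero (n : ℕ) : scaling 0 n = 1 := by simp [scaling]

theorem natCast_mul_scaling {γ : ℝ} (hγ : γ < 1) (n : ℕ) :
    n * scaling γ n = (n : ℝ) ^ (1 - γ) := by
  rw [scaling, sub_eq_add_neg, Real.rpow_one_add' n.cast_nonneg (by linarith)]

theorem summable_mul_exp_neg_scaling {γ : ℝ} (hγ : γ < 1) {c : ℝ} (hc : 0 < c) :
    Summable fun n : ℕ => n * Real.exp (-c * (n * scaling γ n)) := by
  simpa only [natCast_mul_scaling hγ] using summable_mul_exp_neg_rpow hc (sub_pos.2 hγ)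

theorem tendsto_inv_scaling {γ : ℝ} (hγ : 0 < γ) :
    Tendsto (fun n => (scaling γ n)⁻¹) atTop atTop := by
  simpa only [scaling, Real.rpow_neg (Nat.cast_nonneg _), inv_inv, Function.comp_def] using
    (tendsto_rpow_atTop hγ).comp tendsto_natCast_atTop_atTop

end Scaling

section MeanGraphon

theorem abs_min_le_abs {c x : ℝ} (hc : 0 ≤ c) : |min c x| ≤ |x| := by
  rcases le_total c x with h | h
  · rw [min_eq_left h, abs_of_nonneg hc]
    exact h.trans (le_abs_self x)
  · rw [min_eq_right h]

theorem tendsto_eLpNorm_min_sub {X : Type*} [MeasurableSpace X] {μ : Measure X} {V : X → ℝ}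
    (hV : Integrable V μ) {c : ℕ → ℝ} (hc : ∀ n, 0 ≤ c n) (hc_top : Tendsto c atTop atTop) :
    Tendsto (fun n => eLpNorm ((fun x => min (c n) (V x)) - V) 1 μ) atTop (𝓝 0) := by
  have hbound : ∀ n x, ‖min (c n) (V x) - V x‖ₑ ≤ ‖V x‖ₑ := by
    refine fun n x => enorm_le_iff_norm_le.2 ?_
    rcases le_total (c n) (V x) with h | h
    · rw [min_eq_left h, Real.norm_eq_abs, Real.norm_eq_abs, abs_of_nonpos (by linarith),
        abs_of_nonneg ((hc n).trans h)]
      linarith [hc n]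
    · rw [min_eq_right h, sub_self, norm_zero]
      exact norm_nonneg _
  have hpointwise : ∀ x, Tendsto (fun n => ‖min (c n) (V x) - V x‖ₑ) atTop (𝓝 0) := by
    refine fun x => tendsto_nhds_of_eventually_eq ?_
    filter_upwards [hc_top.eventually_ge_atTop (V x)] with n hn
    rw [min_eq_right hn, sub_self, enorm_zero]
  simp only [eLpNorm_one_eq_lintegral_enorm, Pi.sub_apply]
  simpa only [lintegral_zero] using tendsto_lintegral_of_dominated_convergence'
    (F := fun n x => ‖min (c n) (V x) - V x‖ₑ) (f := fun _ => 0) (fun x => ‖V x‖ₑ)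
    (fun n => ((aestronglyMeasurable_const.inf hV.1).sub hV.1).enorm)
    (fun n => ae_of_all _ (hbound n)) hV.2.ne (ae_of_all _ hpointwise)

/-- The graphon whose cell averages, multiplied by `n ^ (-γ)`, are the expected weights on `n`
nodes of a graph sequence generated from `W`. -/
def meanGraphon (T : GraphType) (γ : ℝ) (W : ℝ × ℝ → ℝ) (n : ℕ) : ℝ × ℝ → ℝ :=
  match T with
  | .deterministicDense => W
  | .randomDense => W
  | .randomSparse => fun p => min (scaling γ n)⁻¹ (W p)

variable {W : ℝ × ℝ → ℝ} {C : ℝ≥0}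

theorem IsSchurKernel.isSchurKernel_meanGraphon (hW : IsSchurKernel μI W C) (T : GraphType)
    (γ : ℝ) (n : ℕ) : IsSchurKernel μI (meanGraphon T γ W n) C := by
  cases T
  · exact hW
  · exact hW
  · exact hW.mono (aestronglyMeasurable_const.inf hW.aestronglyMeasurable) fun p =>
      abs_min_le_abs (inv_nonneg.2 (scaling_nonneg γ n))

theorem IsSchurKernel.tendsto_meanGraphon (hW : IsSchurKernel μI W C) {T : GraphType} {γ : ℝ}
    (hγ : T = .randomSparse → 0 < γ) :
    Tendsto (fun n => eLpNorm (meanGraphon T γ W n - W) 1 (μI.prod μI)) atTop (𝓝 0) := by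
  cases T
  · simp [meanGraphon]
  · simp [meanGraphon]
  · exact tendsto_eLpNorm_min_sub hW.integrable (fun n => inv_nonneg.2 (scaling_nonneg γ n))
      (tendsto_inv_scaling (hγ rfl))

/-- The matrix of the cell averages of the mean graphon. -/
def meanWeight (T : GraphType) (γ : ℝ) (W : ℝ × ℝ → ℝ) (n : ℕ) : Fin n → Fin n → ℝ :=
  cellAvg (meanGraphon T γ W n) n

theorem IsSchurKernel.isSchurMatrix_meanWeight (hW : IsSchurKernel μI W C) (T : GraphType)
    (γ : ℝ) (n : ℕ) : IsSchurMatrix (meanWeight T γ W n) C :=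
  (hW.isSchurKernel_meanGraphon T γ n).isSchurMatrix_cellAvg n

theorem IsSchurKernel.tendsto_stepKernel_meanWeight (hW : IsSchurKernel μI W C) {T : GraphType}
    {γ : ℝ} (hγ : T = .randomSparse → 0 < γ) :
    Tendsto (fun n => eLpNorm (stepKernel n (meanWeight T γ W n) - W) 1 (μI.prod μI)) atTop
      (𝓝 0) := by
  simp only [meanWeight, stepKernel_cellAvg]
  exact isVanishingMesh_cellProd.tendsto_partAvg_of_tendsto le_rfl ENNReal.one_ne_top
    (memLp_one_iff_integrable.2 hW.integrable)
    (fun n => memLp_one_iff_integrable.2 (hW.isSchurKernel_meanGraphon T γ n).integrable)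
    (hW.tendsto_meanGraphon hγ)

theorem IsSchurKernel.tendsto_interactionL2_meanWeight (hW : IsSchurKernel μI W C)
    {T : GraphType} {γ : ℝ} (hγ : T = .randomSparse → 0 < γ) {D : ℝ → ℝ} {L : ℝ≥0} {B : ℝ}
    (hD : LipschitzWith L D) (hB : ∀ z, |D z| ≤ B) (φ : L2I) :
    Tendsto (fun n => interactionL2 μI (stepKernel n (meanWeight T γ W n)) D
      (stepLp n (cellMean n φ))) atTop (𝓝 (interactionL2 μI W D φ)) := by
  have hmean : ∀ᶠ n in atTop, IsSchurKernel μI (stepKernel n (meanWeight T γ W n)) C :=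
    (eventually_gt_atTop 0).mono fun n hn =>
      (hW.isSchurMatrix_meanWeight T γ n).isSchurKernel_stepKernel hn
  exact tendsto_of_eventually_lipschitzWith
    (hmean.mono fun n hn => hn.lipschitzWith_interactionL2 hD hB)
    (by simpa only [dist_comm] using
      tendsto_iff_dist_tendsto_zero.1 (tendsto_stepLp_cellMean φ))
    (tendsto_interactionL2 hmean hW (hW.tendsto_stepKernel_meanWeight hγ) hD.continuous hB φ)

theorem cellAvg_nonneg {V : ℝ × ℝ → ℝ} (hV : ∀ᵐ p ∂(μI.prod μI), 0 ≤ V p) (n : ℕ)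
    (i j : Fin n) : 0 ≤ cellAvg V n i j := by
  have hV' : ∀ᵐ p ∂(volume.restrict (cell n i ×ˢ cell n j)), 0 ≤ V p :=
    prod_restrict_cellProd n (i, j) ▸ ae_restrict_of_ae hV
  exact mul_nonneg (by positivity) (integral_nonneg_of_ae hV')

end MeanGraphon

section Graphs

variable {Ω : Type*} [MeasurableSpace Ω] {P : Measure Ω} {m : ℕ}
  {ty : Fin m → GraphType} {und : Fin m → Prop} {W : Fin m → ℝ × ℝ → ℝ} {γ : Fin m → ℝ}
  {w : (n : ℕ) → Fin m → Fin n → Fin n → Ω → ℝ}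

namespace IsGraphSequence

theorem indep_row (hw : IsGraphSequence P ty und W γ w) (n : ℕ) (k : Fin m) (i : Fin n) :
    iIndepFun (fun j => w n k i j) P := by
  by_cases hk : und k
  · let e : Fin n → {e : Fin m × Fin n × Fin n // und e.1 → e.2.1 ≤ e.2.2} :=
      fun j => ⟨(k, min i j, max i j), fun _ => min_le_max⟩
    have he : Function.Injective e := by
      intro j j' h
      simp only [e, Subtype.mk.injEq, Prod.mk.injEq, true_and] at h
      grind
    have hrow : (fun j => w n k i j) = fun j ω => w n (e j).1.1 (e j).1.2.1 (e j).1.2.2 ω := by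
      funext j ω
      rcases le_total i j with hij | hij
      · simp [e, hij]
      · simpa [e, hij] using hw.weight_symm k hk n i j ω
    exact hrow ▸ (hw.indep n).precomp he
  · exact (hw.indep n).precomp (g := fun j => ⟨(k, i, j), fun h => absurd h hk⟩)
      fun j j' h => by simpa using h

theorem indep_col (hw : IsGraphSequence P ty und W γ w) (n : ℕ) (k : Fin m) (j : Fin n) :
    iIndepFun (fun i => w n k i j) P := by
  by_cases hk : und k
  · have hcol : (fun i => w n k i j) = fun i => w n k j i :=
      funext₂ fun i ω => hw.weight_symm k hk n i j ω
    exact hcol ▸ hw.indep_row n k j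
  · exact (hw.indep n).precomp (g := fun i => ⟨(k, i, j), fun h => absurd h hk⟩)
      fun i i' h => by simpa using h

theorem meanWeight_nonneg (hw : IsGraphSequence P ty und W γ w) {k : Fin m}
    (hk : ty k ≠ .deterministicDense) (n : ℕ) (i j : Fin n) :
    0 ≤ meanWeight (ty k) (γ k) (W k) n i j := by
  refine cellAvg_nonneg ?_ n i j
  rcases h : ty k with _ | _ | _
  · exact absurd h hk
  · filter_upwards [hw.dense_range k h] with p hp using hp.1
  · filter_upwards [hw.sparse_nonneg k h] with p hp
    exact le_min (inv_nonneg.2 (scaling_nonneg _ n)) hp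

variable {k : Fin m} (hγ : ty k ≠ .randomSparse → γ k = 0)
include hγ

theorem measure_weight_eq_one (hw : IsGraphSequence P ty und W γ w)
    (hk : ty k ≠ .deterministicDense) (n : ℕ) (i j : Fin n) :
    P {ω | w n k i j ω = 1} =
      ENNReal.ofReal (scaling (γ k) n * meanWeight (ty k) (γ k) (W k) n i j) := by
  rcases h : ty k with _ | _ | _
  · exact absurd h hk
  · rw [hw.dense_prob k h, hγ (by simp [h]), scaling_zero, one_mul]
    rfl
  · exact hw.sparse_prob k h n i j

theorem weight_eq_of_deterministic (hw : IsGraphSequence P ty und W γ w)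
    (hk : ty k = .deterministicDense) (n : ℕ) (i j : Fin n) (ω : Ω) :
    w n k i j ω = scaling (γ k) n * meanWeight (ty k) (γ k) (W k) n i j := by
  rw [hw.deterministic k hk, hγ (by simp [hk]), scaling_zero, one_mul, hk]
  rfl

theorem isConstOrBernoulli_row (hw : IsGraphSequence P ty und W γ w) :
    IsConstOrBernoulli P (fun n i j => w n k i j) fun n i j =>
      scaling (γ k) n * meanWeight (ty k) (γ k) (W k) n i j := by
  by_cases hk : ty k = .deterministicDense
  · exact Or.inl (hw.weight_eq_of_deterministic hγ hk)
  · exact Or.inr fun n i =>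
      { measurable := hw.measurable n k i
        zero_or_one := hw.zero_or_one k hk n i
        nonneg := fun j => mul_nonneg (scaling_nonneg _ n) (hw.meanWeight_nonneg hk n i j)
        prob := hw.measure_weight_eq_one hγ hk n i
        indep := hw.indep_row n k i }

theorem isConstOrBernoulli_col (hw : IsGraphSequence P ty und W γ w) :
    IsConstOrBernoulli P (fun n j i => w n k i j) fun n j i =>
      scaling (γ k) n * meanWeight (ty k) (γ k) (W k) n i j := by
  by_cases hk : ty k = .deterministicDense
  · exact Or.inl fun n j i => hw.weight_eq_of_deterministic hγ hk n i j
  · exact Or.inr fun n j =>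
      { measurable := fun i => hw.measurable n k i j
        zero_or_one := fun i => hw.zero_or_one k hk n i j
        nonneg := fun i => mul_nonneg (scaling_nonneg _ n) (hw.meanWeight_nonneg hk n i j)
        prob := fun i => hw.measure_weight_eq_one hγ hk n i j
        indep := hw.indep_col n k j }

end IsGraphSequence

theorem sum_abs_scaling_mul_le {n : ℕ} {c : Fin n → ℝ} {C : ℝ} (hc : ∑ j, |c j| ≤ C * n) (γ : ℝ) :
    ∑ j, |scaling γ n * c j| ≤ C * (n * scaling γ n) := by
  simp only [abs_mul, abs_of_nonneg (scaling_nonneg γ n), ← Finset.mul_sum]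
  calc scaling γ n * ∑ j, |c j| ≤ scaling γ n * (C * n) :=
        mul_le_mul_of_nonneg_left hc (scaling_nonneg γ n)
    _ = C * (n * scaling γ n) := by ring

theorem sum_abs_div_scaling_le {n : ℕ} (hn : 0 < n) {c : Fin n → ℝ} {C γ : ℝ}
    (hc : ∑ j, |c j| ≤ C * (n * scaling γ n)) : ∑ j, |c j / scaling γ n| ≤ C * n := by
  simp only [abs_div, abs_of_pos (scaling_pos γ hn), ← Finset.sum_div]
  exact (div_le_iff₀ (scaling_pos γ hn)).2 (by linarith)

/-- The weight matrix of the `k`-th graph on `n` nodes, divided by the scaling factor. -/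
def scaledWeight (γ : Fin m → ℝ) (w : (n : ℕ) → Fin m → Fin n → Fin n → Ω → ℝ) (ω : Ω) (n : ℕ)
    (k : Fin m) (i j : Fin n) : ℝ :=
  w n k i j ω / scaling (γ k) n

namespace IsGraphSequence

variable [IsProbabilityMeasure P] {k : Fin m} {C : ℝ≥0} {D : ℝ → ℝ} {B : ℝ} {L : ℝ≥0}

theorem ae_eventually_isSchurMatrix (hw : IsGraphSequence P ty und W γ w)
    (hγ_dense : ty k ≠ .randomSparse → γ k = 0) (hγ : γ k < 1) (hW : IsSchurKernel μI (W k) C) :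
    ∀ᵐ ω ∂P, ∀ᶠ n in atTop, IsSchurMatrix (scaledWeight γ w ω n k) (C + 1 : ℝ≥0) := by
  have hmean := hW.isSchurMatrix_meanWeight (ty k) (γ k)
  have hs : ∀ n : ℕ, 0 ≤ n * scaling (γ k) n := fun n =>
    mul_nonneg n.cast_nonneg (scaling_nonneg _ n)
  filter_upwards [(hw.isConstOrBernoulli_row hγ_dense).ae_eventually_sum_abs_le hs
      (fun _ => summable_mul_exp_neg_scaling hγ) C.coe_nonneg
      fun n i => sum_abs_scaling_mul_le ((hmean n).row i) _,
    (hw.isConstOrBernoulli_col hγ_dense).ae_eventually_sum_abs_le hs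
      (fun _ => summable_mul_exp_neg_scaling hγ) C.coe_nonneg
      fun n j => sum_abs_scaling_mul_le ((hmean n).col j) _] with ω hrow hcol
  filter_upwards [hrow, hcol, eventually_gt_atTop 0] with n hrow hcol hn
  exact ⟨fun i => sum_abs_div_scaling_le hn (hrow i), fun j => sum_abs_div_scaling_le hn (hcol j)⟩

theorem ae_tendsto_stepLp_networkInteraction_sub (hw : IsGraphSequence P ty und W γ w)
    (hγ_dense : ty k ≠ .randomSparse → γ k = 0) (hγ : γ k < 1) (hW : IsSchurKernel μI (W k) C)
    (hB : ∀ z, |D z| ≤ B) (v : (n : ℕ) → Fin n → ℝ) :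
    ∀ᵐ ω ∂P, Tendsto (fun n => stepLp n (networkInteraction n (scaledWeight γ w ω n k) D (v n)) -
      stepLp n (networkInteraction n (meanWeight (ty k) (γ k) (W k) n) D (v n))) atTop (𝓝 0) := by
  have hmean := hW.isSchurMatrix_meanWeight (ty k) (γ k)
  filter_upwards [(hw.isConstOrBernoulli_row hγ_dense).ae_forall_eventually_abs_sum_le_mul
    (fun n => mul_nonneg n.cast_nonneg (scaling_nonneg _ n))
    (fun _ => summable_mul_exp_neg_scaling hγ) C.coe_nonneg
    (fun n i => sum_abs_scaling_mul_le ((hmean n).row i) _) ((abs_nonneg _).trans (hB 0))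
    (a := fun n i j => D (v n j - v n i)) fun n i j => hB _] with ω hω
  refine Metric.tendsto_nhds.2 fun ε hε => ?_
  filter_upwards [hω (ε / 2) (half_pos hε), eventually_gt_atTop 0] with n hfluct hn
  have hn' : (0 : ℝ) < n := by exact_mod_cast hn
  have hα := scaling_pos (γ k) hn
  rw [dist_zero_right, ← stepLp_sub]
  refine (norm_stepLp_le (half_pos hε).le fun i => ?_).trans_lt (half_lt_self hε)
  have hdiff : (networkInteraction n (scaledWeight γ w ω n k) D (v n) -
      networkInteraction n (meanWeight (ty k) (γ k) (W k) n) D (v n)) i =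
      (∑ j, D (v n j - v n i) *
        (w n k i j ω - scaling (γ k) n * meanWeight (ty k) (γ k) (W k) n i j)) /
        (n * scaling (γ k) n) := by
    rw [Pi.sub_apply, networkInteraction, networkInteraction, ← mul_sub,
      ← Finset.sum_sub_distrib, Finset.mul_sum, Finset.sum_div]
    refine Finset.sum_congr rfl fun j _ => ?_
    rw [scaledWeight]
    field_simp
  rw [hdiff, abs_div, abs_of_pos (mul_pos hn' hα)]
  exact (div_le_iff₀ (mul_pos hn' hα)).2 (hfluct i)

/- On step functions both the rescaled graph and the averaged kernel act as networks, so their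
interactions differ by a concentrated sum; equi-Lipschitz continuity passes from these to `φ`. -/
theorem ae_tendsto_interactionL2 (hw : IsGraphSequence P ty und W γ w)
    (hγ_dense : ty k ≠ .randomSparse → γ k = 0) (hγ_sparse : ty k = .randomSparse → 0 < γ k)
    (hγ : γ k < 1) (hW : IsSchurKernel μI (W k) C)
    (hD : LipschitzWith L D) (hB : ∀ z, |D z| ≤ B) (φ : L2I) :
    ∀ᵐ ω ∂P, Tendsto (fun n => interactionL2 μI (stepKernel n (scaledWeight γ w ω n k)) D φ) atTop
      (𝓝 (interactionL2 μI (W k) D φ)) := by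
  filter_upwards [hw.ae_eventually_isSchurMatrix hγ_dense hγ hW,
    hw.ae_tendsto_stepLp_networkInteraction_sub hγ_dense hγ hW hB fun n => cellMean n φ]
    with ω hSchur hfluct
  have hlip : ∀ᶠ n in atTop, LipschitzWith (2 * L * (C + 1))
      (interactionL2 μI (stepKernel n (scaledWeight γ w ω n k)) D) := by
    filter_upwards [hSchur, eventually_gt_atTop 0] with n hn hn0
    exact (hn.isSchurKernel_stepKernel hn0).lipschitzWith_interactionL2 hD hB
  have hmean := hW.tendsto_interactionL2_meanWeight hγ_sparse hD hB φ
  refine tendsto_of_eventually_lipschitzWith hlip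
    (tendsto_iff_dist_tendsto_zero.1 (tendsto_stepLp_cellMean φ)) ?_
  refine (add_zero (interactionL2 μI (W k) D φ) ▸ hmean.add hfluct).congr' ?_
  filter_upwards [eventually_gt_atTop 0] with n hn
  rw [interactionL2_stepKernel hn, interactionL2_stepKernel hn, add_sub_cancel]

end IsGraphSequence

end Graphs

section AllGraphs

variable {Ω : Type*} [MeasurableSpace Ω] {P : Measure Ω} [IsProbabilityMeasure P] {m : ℕ}
  {ty : Fin m → GraphType} {und : Fin m → Prop} {W : Fin m → ℝ × ℝ → ℝ} {γ : Fin m → ℝ}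
  {w : (n : ℕ) → Fin m → Fin n → Fin n → Ω → ℝ} {C : ℝ≥0} {D : Fin m → ℝ → ℝ} {B : Fin m → ℝ}
  {L : Fin m → ℝ≥0}

namespace IsGraphSequence

theorem ae_eventually_lipschitzWith_couplingL2 (hw : IsGraphSequence P ty und W γ w)
    (hγ_dense : ∀ k, ty k ≠ .randomSparse → γ k = 0) (hγ : ∀ k, γ k < 1)
    (hW : ∀ k, IsSchurKernel μI (W k) C) (hD : ∀ k, LipschitzWith (L k) (D k))
    (hB : ∀ k z, |D k z| ≤ B k) :
    ∀ᵐ ω ∂P, ∀ᶠ n in atTop, LipschitzWith (∑ k, 2 * L k * (C + 1))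
      (couplingL2 μI (fun k => stepKernel n (scaledWeight γ w ω n k)) D) := by
  filter_upwards [ae_all_iff.2 fun k => hw.ae_eventually_isSchurMatrix (hγ_dense k)
    (hγ k) (hW k)] with ω hω
  filter_upwards [eventually_all.2 hω, eventually_gt_atTop 0] with n hn hn0
  exact lipschitzWith_couplingL2 (fun k => (hn k).isSchurKernel_stepKernel hn0) hD hB

theorem ae_tendsto_couplingL2 (hw : IsGraphSequence P ty und W γ w)
    (hγ_dense : ∀ k, ty k ≠ .randomSparse → γ k = 0)
    (hγ_sparse : ∀ k, ty k = .randomSparse → 0 < γ k) (hγ : ∀ k, γ k < 1)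
    (hW : ∀ k, IsSchurKernel μI (W k) C) (hD : ∀ k, LipschitzWith (L k) (D k))
    (hB : ∀ k z, |D k z| ≤ B k) (φ : L2I) :
    ∀ᵐ ω ∂P, Tendsto (fun n =>
      couplingL2 μI (fun k => stepKernel n (scaledWeight γ w ω n k)) D φ) atTop
      (𝓝 (couplingL2 μI W D φ)) := by
  filter_upwards [ae_all_iff.2 fun k => hw.ae_tendsto_interactionL2 (hγ_dense k) (hγ_sparse k)
    (hγ k) (hW k) (hD k) (hB k) φ] with ω hω
  exact tendsto_finsetSum _ fun k _ => hω k

end IsGraphSequence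

end AllGraphs

section Equations

variable {m : ℕ} {f : ℝ → ℝ → ℝ} {D : Fin m → ℝ → ℝ} {g : L2I}

theorem IsDiscreteSolution.stepLp_zero {n : ℕ} {α : Fin m → ℝ} {w : Fin m → Fin n → Fin n → ℝ}
    {v : ℝ → Fin n → ℝ} (hv : IsDiscreteSolution f D g n α w v) :
    stepLp n (v 0) = stepLp n (cellMean n g) :=
  congrArg (stepLp n) (funext hv.initial)

theorem IsDiscreteSolution.hasDerivAt_stepLp {n : ℕ} {α : Fin m → ℝ}
    {w : Fin m → Fin n → Fin n → ℝ} {v : ℝ → Fin n → ℝ}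
    (hv : IsDiscreteSolution f D g n α w v) (t : ℝ) :
    HasDerivAt (fun s => stepLp n (v s))
      (stepLp n ((f · t) ∘ v t +
        ∑ k, networkInteraction n (fun i j => w k i j / α k) (D k) (v t))) t := by
  have hvelocity : ∀ i, ((f · t) ∘ v t +
      ∑ k, networkInteraction n (fun i j => w k i j / α k) (D k) (v t)) i =
      f (v t i) t + ∑ k, 1 / (n * α k) * ∑ j, w k i j * D k (v t j - v t i) := fun i => by
    simp only [Pi.add_apply, Function.comp_apply, Finset.sum_apply, networkInteraction,
      Finset.mul_sum]
    refine congrArg _ (Finset.sum_congr rfl fun k _ => Finset.sum_congr rfl fun j _ => ?_)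
    field_simp
  exact HasDerivAt.fun_sum fun i _ => (hvelocity i ▸ hv.ode t i).smul_const _

theorem IsDiscreteSolution.hasDerivAt {n : ℕ} (hn : 0 < n) {α : Fin m → ℝ}
    {w : Fin m → Fin n → Fin n → ℝ} {v : ℝ → Fin n → ℝ}
    (hv : IsDiscreteSolution f D g n α w v) (t : ℝ) :
    HasDerivAt (fun s => stepLp n (v s))
      (nemytskiiL2 μI (f · t) (stepLp n (v t)) +
        couplingL2 μI (fun k => stepKernel n fun i j => w k i j / α k) D (stepLp n (v t))) t := by
  simpa only [stepLp_add, stepLp_sum, nemytskiiL2_stepLp hn, couplingL2,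
    interactionL2_stepKernel hn] using hv.hasDerivAt_stepLp t

theorem IsContinuumSolution.hasDerivAt {W : Fin m → ℝ × ℝ → ℝ} {u : ℝ → L2I} {A C : ℝ≥0}
    {B : Fin m → ℝ} (hu : IsContinuumSolution f D W g u) (hf : ∀ t, LipschitzWith A (f · t))
    (hW : ∀ k, IsSchurKernel μI (W k) C) (hD : ∀ k, Continuous (D k))
    (hB : ∀ k z, |D k z| ≤ B k) (t : ℝ) :
    HasDerivAt u (nemytskiiL2 μI (f · t) (u t) + couplingL2 μI W D (u t)) t := by
  have hderiv : deriv u t = nemytskiiL2 μI (f · t) (u t) + couplingL2 μI W D (u t) := by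
    refine Lp.ext ?_
    have hint : ∀ᵐ x ∂μI, ∀ k, interactionL2 μI (W k) (D k) (u t) x =
        interaction μI (W k) (D k) (u t) x :=
      ae_all_iff.2 fun k => coeFn_toL2 <|
        (hW k).memLp_interaction (hD k) (hB k) (Lp.aestronglyMeasurable (u t))
    filter_upwards [hu.equation t, hint,
      coeFn_toL2 (memLp_comp_of_lipschitzWith (hf t) (Lp.memLp (u t))),
      Lp.coeFn_add (nemytskiiL2 μI (f · t) (u t)) (couplingL2 μI W D (u t)),
      Lp.coeFn_fun_finsetSum Finset.univ fun k => interactionL2 μI (W k) (D k) (u t)]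
      with x hx hint hfx hadd hsum
    rw [hx, hadd, Pi.add_apply, couplingL2, hsum, nemytskiiL2, hfx]
    simp only [hint, interaction, Function.comp_apply]
  exact hderiv ▸ (hu.contDiff.differentiable one_ne_zero t).hasDerivAt

end Equations

end

end OscillatorNetwork

open OscillatorNetwork in
theorem theorem2_general {Ω : Type*} [MeasurableSpace Ω] (P : Measure Ω) [IsProbabilityMeasure P]
    (m : ℕ) (f : ℝ → ℝ → ℝ) (D : Fin m → ℝ → ℝ) (W : Fin m → ℝ × ℝ → ℝ) (g : L2I)
    (hf_lip : ∃ L : ℝ≥0, ∀ t, LipschitzWith L (fun x => f x t))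
    (hD_lip : ∀ k, ∃ L : ℝ≥0, LipschitzWith L (D k))
    (hD_bdd : ∀ k, ∃ B : ℝ, ∀ x, |D k x| ≤ B)
    (hW : ∀ k, AEStronglyMeasurable (W k) (μI.prod μI)) (C₁ C₂ : ℝ≥0)
    (hW_col : ∀ k, essSup (fun y => ∫⁻ x, ‖W k (x, y)‖ₑ ∂μI) μI ≤ C₁)
    (hW_row : ∀ k, essSup (fun x => ∫⁻ y, ‖W k (x, y)‖ₑ ∂μI) μI ≤ C₂)
    (ty : Fin m → GraphType) (und : Fin m → Prop) (γ : Fin m → ℝ)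
    (hγ_dense : ∀ k, ty k ≠ .randomSparse → γ k = 0)
    (hγ_sparse : ∀ k, ty k = .randomSparse → γ k ∈ Ioo (0 : ℝ) 1)
    (w : (n : ℕ) → Fin m → Fin n → Fin n → Ω → ℝ) (hw : IsGraphSequence P ty und W γ w)
    (v : (n : ℕ) → Ω → ℝ → Fin n → ℝ)
    (hv : ∀ n ω, IsDiscreteSolution f D g n (fun k => scaling (γ k) n)
      (fun k i j => w n k i j ω) (v n ω))
    (u : ℝ → L2I) (hu : IsContinuumSolution f D W g u) :
    ∀ᵐ ω ∂P, ∀ T : ℝ, 0 < T → ∃ M : ℕ → ℝ,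
      (∀ n, IsGreatest ((fun t => ‖stepLp n (v n ω t) - u t‖) '' Icc 0 T) (M n)) ∧
      Tendsto M atTop (𝓝 0) := by
  obtain ⟨A, hf⟩ := hf_lip
  choose L hD using hD_lip
  choose B hB using hD_bdd
  have hγ_lt : ∀ k, γ k < 1 := fun k => by
    by_cases hk : ty k = .randomSparse
    exacts [(hγ_sparse k hk).2, hγ_dense k hk ▸ one_pos]
  have hK : ∀ k, IsSchurKernel μI (W k) (C₁ + C₂) := fun k =>
    .of_essSup_le (hW k) ((hW_row k).trans (by simp)) ((hW_col k).trans (by simp))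
  have : Fact ((2 : ℝ≥0∞) ≠ ⊤) := ⟨ENNReal.ofNat_ne_top⟩
  obtain ⟨S, hS_countable, hS⟩ := TopologicalSpace.exists_countable_dense L2I
  have hu_deriv := hu.hasDerivAt hf hK (fun k => (hD k).continuous) hB
  filter_upwards [hw.ae_eventually_lipschitzWith_couplingL2 hγ_dense hγ_lt hK hD hB,
    (ae_ball_iff hS_countable).2 fun φ _ => hw.ae_tendsto_couplingL2 hγ_dense
      (fun k hk => (hγ_sparse k hk).1) hγ_lt hK hD hB φ] with ω hlip hcons T hT
  refine exists_isGreatest_norm_sub_tendsto_zero isCompact_Icc (nonempty_Icc.2 hT.le)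
    (fun n t _ => ((hv n ω).hasDerivAt_stepLp t).continuousAt.continuousWithinAt)
    (fun t _ => (hu_deriv t).continuousAt.continuousWithinAt) ?_
  exact tendstoUniformlyOn_of_dense_consistent (fun t => lipschitzWith_nemytskiiL2 (hf t)) hlip
    (lipschitzWith_couplingL2 (fun k => (hK k).weaken le_self_add) hD hB) hS hcons
    ((eventually_gt_atTop 0).mono fun n hn => (hv n ω).hasDerivAt hn) hu_deriv
    (by simpa only [(hv _ ω).stepLp_zero, hu.initial] using tendsto_stepLp_cellMean g) T

open OscillatorNetwork in
theorem theorem2 {Ω : Type*} [MeasurableSpace Ω] (P : Measure Ω) [IsProbabilityMeasure P]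
    (m : ℕ) (f : ℝ → ℝ → ℝ) (D : Fin m → ℝ → ℝ) (W : Fin m → ℝ × ℝ → ℝ) (g : L2I)
    -- `f(u,t)` is Lipschitz in `u` and continuous in `t`
    (hf_lip : ∃ L : ℝ≥0, ∀ t, LipschitzWith L (fun x => f x t))
    (hf_cont : ∀ x, Continuous (f x))
    -- the `D k` are Lipschitz and bounded
    (hD_lip : ∀ k, ∃ L : ℝ≥0, LipschitzWith L (D k))
    (hD_bdd : ∀ k, ∃ B : ℝ, ∀ x, |D k x| ≤ B)
    -- the graphons are square integrable, with bounded columns and rows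
    (hW : ∀ k, MemLp (W k) 2 (μI.prod μI))
    (C₁ C₂ : ℝ≥0)
    (hW_col : ∀ k, essSup (fun y => ∫⁻ x, ‖W k (x, y)‖ₑ ∂μI) μI ≤ C₁)
    (hW_row : ∀ k, essSup (fun x => ∫⁻ y, ‖W k (x, y)‖ₑ ∂μI) μI ≤ C₂)
    -- the graphs
    (ty : Fin m → GraphType) (und : Fin m → Prop) (γ : Fin m → ℝ)
    (hγ_dense : ∀ k, ty k ≠ .randomSparse → γ k = 0)
    (hγ_sparse : ∀ k, ty k = .randomSparse → γ k ∈ Ioo (0 : ℝ) (1 / 2))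
    (w : (n : ℕ) → Fin m → Fin n → Fin n → Ω → ℝ)
    (hw : IsGraphSequence P ty und W γ w)
    -- the solutions of the network equations and of the continuum limit
    (v : (n : ℕ) → Ω → ℝ → Fin n → ℝ)
    (hv : ∀ n ω, IsDiscreteSolution f D g n (fun k => scaling (γ k) n)
      (fun k i j => w n k i j ω) (v n ω))
    (u : ℝ → L2I) (hu : IsContinuumSolution f D W g u) :
    ∀ T : ℝ, 0 < T → ∀ᵐ ω ∂P, ∃ M : ℕ → ℝ,
      (∀ n, IsGreatest ((fun t => ‖stepLp n (v n ω t) - u t‖) '' Icc 0 T) (M n)) ∧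
      Tendsto M atTop (𝓝 0) :=
  fun T hT => (theorem2_general P m f D W g hf_lip hD_lip hD_bdd (fun k => (hW k).1) C₁ C₂ hW_col
    hW_row ty und γ hγ_dense (fun k hk => Ioo_subset_Ioo_right (by norm_num) (hγ_sparse k hk))
    w hw v hv u hu).mono fun _ hω => hω T hT
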